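/- Conventions. A finite graph $X$ consists of finite sets $V(X)$ of vertices and $H(X)$ of half-edges, a fixed-point-free involution $h\mapsto\bar h$ on $H(X)$ and a root map $r:H(X)\to V(X)$; its edges are the orbits $\{h,\bar h\}$, and $E(X)$ is the set of edges (loops and multiple edges are allowed). We read $h$ as an oriented edge from $r(h)$ to $r(\bar h)$. With $L$ the graph Laplacian, $\mathrm{Jac}(X)=\mathrm{Div}_0(X)/\mathrm{Im}\,L$. Let $G$ be a finite abelian group of order $N$. A harmonic $G$-cover $p:\widetilde X\to X$ is a morphism of finite graphs with local degrees $d(\tilde v)\in\mathbb Z_{>0}$ such that $d(\tilde v)=|\{\tilde h: r(\tilde h)=\tilde v,\ p(\tilde h)=h\}|$ for all $\tilde v\in V(\widetilde X)$ and all half-edges $h$ rooted at $p(\tilde v)$, and $\sum_{p(\tilde v)=v}d(\tilde v)=N$ for all $v\in V(X)$, together with an action of $G$ on $\widetilde X$ by graph automorphisms that flip no edge, preserving $p$ and $d$, transitive on the fibers over vertices, and free and transitive on the fibers over edges. The dilation group $D(v)\subseteq G$ of $v\in V(X)$ is the subgroup fixing all points of $p^{-1}(v)$. A dilated voltage assignment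 of $p$ is given by a lift $\tilde v_0\in p^{-1}(v)$ of each vertex $v$ and elements $\eta_h\in G$ with $\eta_{\bar h}=\eta_h^{-1}$ such that each oriented edge $h$ has a lift to $\widetilde X$ with source $\tilde s_0$ and target $\eta_h\tilde t_0$, where $s=r(h)$ and $t=r(\bar h)$. Let $\rho:G\to\mathbb C^*$ be a nontrivial character. For $F\subseteq E(X)$ let $X\setminus F$ be the graph with the edges in $F$ removed and all vertices kept. A connected component $C$ of $X\setminus F$ is $\rho$-trivial if $\rho(D(v))=\{1\}$ for all $v\in V(C)$ and there is $\xi:V(C)\to\rho(G)$ with $\rho(\eta_h)=\xi(r(\bar h))/\xi(r(h))$ for all half-edges $h$ of $C$. The matroid $\mathcal M^*(\widetilde X/X,\rho)$ on $E(X)$ has as independent sets those $F$ for which no component of $X\setminus F$ is $\rho$-trivial. The weight $w_\rho(F)$ of a basis $F$ is the product over the components $C$ of $X\setminus F$ of $|1-\rho(\eta(C))|^2$ if $C$ is unicyclic, where $\eta(C)$ is the product of the $\eta_h$ along the cycle of $C$, and of $1$ if $C$ is a tree. Let $w(\mathcal M^*(\widetilde X/X,\rho))=\sum_F w_\rho(F)$,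 the sum being over all bases $F$. Theorem. Let $p:\widetilde X\to X$ be a harmonic $G$-cover with $G$ finite abelian of order $N$ and with $\widetilde X$ connected (hence also $X$), and fix any dilated voltage assignment of $p$. Then $|\mathrm{Jac}(\widetilde X)|$ and $|\mathrm{Jac}(X)|$ are the numbers of spanning trees of $\widetilde X$ and $X$; for each nontrivial character $\rho$ of $G$ the sets $F$ described above are the independent sets of a matroid $\mathcal M^*(\widetilde X/X,\rho)$; and $$|\mathrm{Jac}(\widetilde X)|=\frac1N\prod_{v\in V(X)}|D(v)|^{N/|D(v)|}\;|\mathrm{Jac}(X)|\prod_{\rho\neq1}w(\mathcal M^*(\widetilde X/X,\rho)),$$ where the last product is over the nontrivial characters $\rho:G\to\mathbb C^*$. -/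

import Mathlib

/-- A graph in the sense of Serre, with vertex set `V` and set of half-edges `H`: a fixed-point-free
involution `bar` on the half-edges and a root map. Loops and multiple edges are allowed. Finiteness
of `V` and `H` is imposed where the graphs are used. A half-edge `h` is also read as the oriented
edge `(h, bar h)`, with source `root h` and target `root (bar h)`. -/
structure SerreGraph (V H : Type*) where
  bar : H → H
  bar_bar : ∀ h, bar (bar h) = h
  bar_ne : ∀ h, bar h ≠ h
  root : H → V

namespace SerreGraph

variable {V H W K G : Type*}

/-! ### Edges, connectedness, cycles, spanning trees -/

/-- Two half-edges are identified when they lie in the same orbit of the involution. -/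
def edgeSetoid (X : SerreGraph V H) : Setoid H where
  r a b := a = b ∨ a = X.bar b
  iseqv :=
    { refl := fun _ => Or.inl rfl
      symm := by
        rintro a b (h | h)
        · exact Or.inl h.symm
        · exact Or.inr (by rw [h, X.bar_bar])
      trans := by
        rintro a b c (h | h) (h' | h')
        · exact Or.inl (h.trans h')
        · exact Or.inr (h.trans h')
        · exact Or.inr (by rw [h, h'])
        · exact Or.inl (by rw [h, h', X.bar_bar]) }

/-- The set of (unoriented) edges `E(X)`: the orbits of the involution. -/
def Edge (X : SerreGraph V H) : Type _ := Quotient X.edgeSetoid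

/-- The edge `{h, bar h}`. -/
def edge (X : SerreGraph V H) (h : H) : X.Edge := Quotient.mk X.edgeSetoid h

instance (X : SerreGraph V H) [Finite H] : Finite X.Edge :=
  inferInstanceAs (Finite (Quotient X.edgeSetoid))

/-- The adjacency relation (without loops and multiplicities) of the subgraph of `X` with all the
vertices of `X` and edge set `S`. It is used only to speak of connectedness and of connected
components, which are those of the subgraph. -/
def adjGraph (X : SerreGraph V H) (S : Set X.Edge) : SimpleGraph V :=
  SimpleGraph.fromRel fun u v => ∃ h, X.edge h ∈ S ∧ X.root h = u ∧ X.root (X.bar h) = v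

/-- The graph is connected (in particular, nonempty). -/
def Connected (X : SerreGraph V H) : Prop := (X.adjGraph Set.univ).Connected

/-- The connected components of `X ∖ F`, the graph obtained from `X` by removing the edges in `F`
and keeping all the vertices. -/
abbrev Component (X : SerreGraph V H) (F : Set X.Edge) : Type _ :=
  (X.adjGraph Fᶜ).ConnectedComponent

/-- The component of `X ∖ F` that contains the vertex `v`. -/
abbrev componentOf (X : SerreGraph V H) (F : Set X.Edge) (v : V) : X.Component F :=
  (X.adjGraph Fᶜ).connectedComponentMk v

/-- A cycle with `n + 1` edges: oriented edges `γ 0, …, γ n`, the target of each being the source of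
the next one (indices modulo `n + 1`), with distinct vertices and distinct underlying edges. Loops
(`n = 0`) and pairs of parallel edges (`n = 1`) are cycles. -/
def IsCycle (X : SerreGraph V H) {n : ℕ} (γ : Fin (n + 1) → H) : Prop :=
  (∀ i, X.root (X.bar (γ i)) = X.root (γ (i + 1))) ∧
    Function.Injective (fun i => X.root (γ i)) ∧ Function.Injective (fun i => X.edge (γ i))

/-- `T` is the edge set of a spanning tree: the subgraph with all vertices and edge set `T` is
connected and contains no cycle. -/
def IsSpanningTree (X : SerreGraph V H) (T : Set X.Edge) : Prop :=
  (X.adjGraph T).Connected ∧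
    ∀ (n : ℕ) (γ : Fin (n + 1) → H), X.IsCycle γ → ¬ ∀ i, X.edge (γ i) ∈ T

/-- The number of spanning trees. -/
noncomputable def numSpanningTrees (X : SerreGraph V H) : ℕ :=
  Nat.card {T : Set X.Edge // X.IsSpanningTree T}

/-! ### The Laplacian and the Jacobian group -/

/-- The Laplacian matrix, valency matrix minus adjacency matrix. Loops at `u` count twice in both
matrices: the half-edges `h` from `u` to `v` are in bijection with the edges between `u` and `v`
if `u ≠ v`, and a loop consists of two of them. -/
noncomputable def laplacian (X : SerreGraph V H) : Matrix V V ℤ := by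
  classical
  exact Matrix.of fun u v =>
    (if u = v then (Nat.card {h : H // X.root h = u} : ℤ) else 0)
      - (Nat.card {h : H // X.root h = u ∧ X.root (X.bar h) = v} : ℤ)

/-- The divisors `a : V → ℤ` of total degree zero. -/
def divZero (V : Type*) [Fintype V] : Submodule ℤ (V → ℤ) where
  carrier := {a | ∑ v, a v = 0}
  zero_mem' := by simp
  add_mem' := by
    intro a b ha hb
    simp only [Set.mem_ofPred_eq, Pi.add_apply, Finset.sum_add_distrib] at *
    rw [ha, hb, add_zero]
  smul_mem' := by
    intro c a ha
    simp only [Set.mem_ofPred_eq, Pi.smul_apply, smul_eq_mul, ← Finset.mul_sum] at *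
    rw [ha, mul_zero]

/-- The Jacobian (critical) group `Div₀(X) / Im L`. -/
abbrev Jac [Fintype V] (X : SerreGraph V H) : Type _ :=
  divZero V ⧸ (LinearMap.range X.laplacian.mulVecLin).submoduleOf (divZero V)

/-! ### Harmonic Galois covers -/

/-- A morphism of graphs, equivariant with respect to the involution and root maps. -/
structure Hom (Y : SerreGraph W K) (X : SerreGraph V H) where
  onV : W → V
  onH : K → H
  map_bar : ∀ k, onH (Y.bar k) = X.bar (onH k)
  map_root : ∀ k, onV (Y.root k) = X.root (onH k)

/-- A harmonic `G`-cover (Galois cover with group `G`) of `X` by `Y`, where `G` acts on the vertices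
and half-edges of `Y`. Since the action preserves the fibers of the half-edges, the edges of `Y`
over an edge `{h, bar h}` correspond `G`-equivariantly to the half-edges of `Y` over `h`. -/
structure HarmonicCover (G : Type*) [Group G] [Fintype G] [Fintype W] [MulAction G W]
    [MulAction G K] (Y : SerreGraph W K) (X : SerreGraph V H) extends Hom Y X where
  /-- `G` acts by graph automorphisms -/
  root_smul : ∀ (g : G) (k : K), Y.root (g • k) = g • Y.root k
  bar_smul : ∀ (g : G) (k : K), Y.bar (g • k) = g • Y.bar k
  /-- no element of `G` flips an edge -/
  no_flip : ∀ (g : G) (k : K), g • k ≠ Y.bar k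
  /-- the local degrees -/
  deg : W → ℕ
  deg_pos : ∀ w, 0 < deg w
  /-- the local balancing condition -/
  balanced : ∀ (w : W) (h : H), X.root h = onV w →
    Nat.card {k : K // Y.root k = w ∧ onH k = h} = deg w
  /-- the global degree is the order of `G` -/
  degree_eq : ∀ v : V, ∑ᶠ (w : W) (_ : onV w = v), deg w = Fintype.card G
  /-- the action preserves the fibers and the local degrees -/
  onV_smul : ∀ (g : G) (w : W), onV (g • w) = onV w
  onH_smul : ∀ (g : G) (k : K), onH (g • k) = onH k
  deg_smul : ∀ (g : G) (w : W), deg (g • w) = deg w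
  /-- `G` acts transitively on the fibers over the vertices -/
  transitive_V : ∀ w w' : W, onV w = onV w' → ∃ g : G, g • w = w'
  /-- `G` acts transitively and freely on the fibers over the edges -/
  transitive_H : ∀ k k' : K, onH k = onH k' → ∃ g : G, g • k = k'
  free_H : ∀ (g : G) (k : K), g • k = k → g = 1

namespace HarmonicCover

section

variable [CommGroup G] [Fintype G] [Fintype W] [MulAction G W] [MulAction G K]
  {Y : SerreGraph W K} {X : SerreGraph V H}

/-- The dilation subgroup `D(v)` (the group `G` is written multiplicatively). -/
def dilation (p : HarmonicCover G Y X) (v : V) : Subgroup G where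
  carrier := {g | ∀ w, p.onV w = v → g • w = w}
  one_mem' := fun w _ => one_smul G w
  mul_mem' := by
    intro a b ha hb w hw
    rw [mul_smul, hb w hw, ha w hw]
  inv_mem' := by
    intro a ha w hw
    rw [inv_smul_eq_iff, ha w hw]

/-- A dilated voltage assignment defining the cover `p`. A lift `base v` of every vertex identifies
`G / D(v)` with the fiber over `v` by `[g] ↦ g • base v`. Every oriented edge `h` has a lift `k` with
source `base (root h)`, so that the fiber over `h` is `{g • k}`, and `η h ∈ G` is such that the
target of `k` is `η h • base (root (bar h))`. Hence the target of `g • k` corresponds to the class of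
`g * η h`. Reversing the orientation inverts `η`. The element `η h` is determined by `base` only
modulo the dilation groups at the two ends, and every representative is allowed. -/
structure Voltage (p : HarmonicCover G Y X) where
  base : V → W
  onV_base : ∀ v, p.onV (base v) = v
  η : H → G
  η_bar : ∀ h, η (X.bar h) = (η h)⁻¹
  exists_lift : ∀ h, ∃ k : K, p.onH k = h ∧ Y.root k = base (X.root h) ∧
    Y.root (Y.bar k) = η h • base (X.root (X.bar h))

end

namespace Voltage

variable [CommGroup G] [Fintype G] [Fintype W] [MulAction G W] [MulAction G K]
  {Y : SerreGraph W K} {X : SerreGraph V H} {p : HarmonicCover G Y X}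

/-- The `ρ`-twisted cover, the `ρ(G)`-cover of `X` with dilation groups `ρ(D(v))` and voltage
assignment `ρ(η)`, is trivial on the component `C` of `X ∖ F`: all the dilation groups `ρ(D(v))` on
`C` are trivial and the restriction of `ρ(η)` to `C` is a coboundary, i.e. its class in
`H¹(C, ρ(G))` vanishes. (Functions with values in `ρ(G)` are written as `ρ ∘ ξ`.) -/
def TwistTrivialOn (e : p.Voltage) (ρ : G →* ℂˣ) (F : Set X.Edge) (C : X.Component F) : Prop :=
  (∀ v, X.componentOf F v = C → ∀ g ∈ p.dilation v, ρ g = 1) ∧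
    ∃ ξ : V → G, ∀ h, X.edge h ∉ F → X.componentOf F (X.root h) = C →
      ρ (e.η h) = ρ (ξ (X.root (X.bar h))) / ρ (ξ (X.root h))

/-- `M` is the `ρ`-twisted matroid `M*(Y/X, ρ)` of the cover: its ground set is `E(X)`, and `F` is
independent if and only if the `ρ`-twisted cover is nontrivial on each component of `X ∖ F`. -/
def IsTwistedMatroid (e : p.Voltage) (ρ : G →* ℂˣ) (M : Matroid X.Edge) : Prop :=
  M.E = Set.univ ∧ ∀ F : Set X.Edge, M.Indep F ↔ ∀ C : X.Component F, ¬ e.TwistTrivialOn ρ F C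

/-- `γ` is a cycle lying in the component `C` of `X ∖ F`. -/
def IsCycleIn (X : SerreGraph V H) (F : Set X.Edge) (C : X.Component F) {n : ℕ}
    (γ : Fin (n + 1) → H) : Prop :=
  X.IsCycle γ ∧ ∀ i, X.edge (γ i) ∉ F ∧ X.componentOf F (X.root (γ i)) = C

open scoped Classical in
/-- The weight of a component `C` of `X ∖ F`: it is `|1 - ρ(η(C))|²` if `C` has a cycle, where
`η(C)` is the product of the voltages along the cycle, and `1` if `C` is a tree. When `F` is a basis
of the twisted matroid, each component that is not a tree has genus one, so that its cycle is unique
up to the starting point and the direction, on which the weight does not depend. -/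
noncomputable def componentWeight (e : p.Voltage) (ρ : G →* ℂˣ) (F : Set X.Edge)
    (C : X.Component F) : ℝ :=
  if h : ∃ γ : (n : ℕ) × (Fin (n + 1) → H), IsCycleIn X F C γ.2 then
    ‖1 - (ρ (∏ i, e.η (h.choose.2 i)) : ℂ)‖ ^ 2
  else 1

/-- The weight `w_ρ(F)`: the product of the weights of the components of `X ∖ F`. -/
noncomputable def weight (e : p.Voltage) (ρ : G →* ℂˣ) (F : Set X.Edge) : ℝ :=
  ∏ᶠ C : X.Component F, e.componentWeight ρ F C

/-- The weight of the matroid: the sum of the weights of its bases. -/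
noncomputable def matroidWeight (e : p.Voltage) (ρ : G →* ℂˣ) (M : Matroid X.Edge) : ℝ :=
  ∑ᶠ (F : Set X.Edge) (_ : M.IsBase F), e.weight ρ F

end Voltage

end HarmonicCover

end SerreGraph

/-!
The proof compares two determinants. Let `N` be the order of `G`, let `L` be the Laplacian of `Y` and
`J` the matrix of ones, and let `A_ρ` be the matrix of the twisted coboundary, which sends `f` to
`h ↦ f (root h) - ρ (η h) f (root (bar h))`, restricted to the functions supported on the set `V_ρ`
of the vertices whose dilation group is killed by `ρ`. A function is called flat on an edge where its
coboundary vanishes.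

*Decomposition.* The functions on the vertices of `Y` split into the isotypic parts of the action of
`G`; the part of a character `ρ` has a basis indexed by `V_ρ`, in which `L` acts by
`diag |D(v)| * A_ρᴴ A_ρ` (`laplacian_mulVec_wave`). The matrix `J` kills the parts with `ρ ≠ 1`.
Hence `det (L + J)` is a product over the characters (`det_laplacian_add_eq_prod_block`). For a
graph with `n` vertices, `det (L + J)` is `n ^ 2` times the number of spanning trees
(`det_laplacian_add_vecMulVec`). At the trivial character the block is a rescaled rank one
perturbation of the Laplacian of `X` and is evaluated in the same way (`det_block_one`). A vertex `v`
lies in `V_ρ` for `N / |D(v)|` characters `ρ`, which produces the exponents of the orders of the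
dilation groups.

*The matroid.* A set `F` of edges is independent for the twisted matroid exactly when no nonzero
function on `V_ρ` is flat off `F` (`forall_not_twistTrivialOn_iff`), because a flat function has
constant absolute value on components. Since `Y` is connected and `ρ` is nontrivial, `A_ρ` is
injective (`eq_zero_of_coboundary_eq_zero`), so these are the sets `F` for which the standard basis
vectors `e ∈ F` have linearly independent images in the cokernel of `A_ρ` (`cokernelMatroid`).

*Weights.* By the Cauchy–Binet formula `det (A_ρᴴ A_ρ)` is the sum of the squared absolute values of
the maximal minors of `A_ρ`. The nonzero minors are those on the complements of the bases `F`, and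
such a minor has as squared absolute value the product of the weights of the components of `X ∖ F`
(`norm_det_eq_prod_weight`): expanding along an edge of a cycle splits off `1 - ρ(η(C))`, and once
all the cycles are gone, expanding along a bridge splits off a unit. With the trivial character and
one vertex removed, the same computation is the matrix tree theorem (`det_laplacian_submatrix`). The
order of the Jacobian is the determinant of the reduced Laplacian because it is the order of its
cokernel (`card_jac`).
-/

/-! ### Determinants and linear matroids -/

namespace Matrix

open Finset

/-- The determinant of a product of rectangular matrices, expanded over all maps between the index
sets. -/
theorem det_mul_eq_sum_fun {m n R : Type*} [Fintype m] [DecidableEq m] [Fintype n] [DecidableEq n]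
    [CommRing R] (M : Matrix n m R) (N : Matrix m n R) :
    (M * N).det = ∑ p : n → m, (M.submatrix id p).det * ∏ i, N (p i) i := by
  simp only [det_apply', mul_apply, prod_univ_sum, mul_sum, Fintype.piFinset_univ, sum_mul,
    submatrix_apply, id_eq]
  rw [Finset.sum_comm]
  refine sum_congr rfl fun p _ => sum_congr rfl fun σ _ => ?_
  rw [prod_mul_distrib, mul_assoc]

/-- The **Cauchy–Binet formula**. The minors are written as determinants of products in which the
rows outside `S` have been replaced by zero. -/
theorem det_mul_eq_sum_powersetCard {m n R : Type*} [Fintype m] [DecidableEq m] [Fintype n]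
    [DecidableEq n] [CommRing R] (M : Matrix n m R) (N : Matrix m n R) :
    (M * N).det = ∑ S ∈ powersetCard (Fintype.card n) (univ : Finset m),
      (M * (diagonal (fun e => if e ∈ S then (1 : R) else 0) * N)).det := by
  simp only [det_mul_eq_sum_fun, diagonal_mul]
  rw [Finset.sum_comm]
  refine sum_congr rfl fun p _ => ?_
  rw [← mul_sum]
  by_cases hp : Function.Injective p
  · congr 1
    rw [sum_eq_single (univ.image p)]
    · simp
    · intro S hS hne
      -- a set of `|n|` elements other than the range of `p` misses a value of `p`
      have : ∃ i, p i ∉ S := by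
        by_contra! h
        refine hne (eq_of_subset_of_card_le ?_ ?_).symm
        · intro x hx
          obtain ⟨i, -, rfl⟩ := mem_image.1 hx
          exact h i
        · rw [card_image_of_injective _ hp, card_univ]
          exact (mem_powersetCard.1 hS).2.le
      obtain ⟨i, hi⟩ := this
      exact prod_eq_zero (mem_univ i) (by simp [hi])
    · intro h
      exact absurd (mem_powersetCard.2 ⟨subset_univ _, by
        rw [card_image_of_injective _ hp, card_univ]⟩) h
  · obtain ⟨i, j, hij, hne⟩ : ∃ i j, p i = p j ∧ i ≠ j := by
      simpa [Function.Injective] using hp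
    rw [det_zero_of_column_eq hne (by simp [hij])]
    simp

/-- The Gram determinant of the rows in `S`, where `S` is as large as the column index, is the
square of the absolute value of a minor. -/
theorem det_conjTranspose_mul_diagonal_mul {m n : Type*} [Fintype m] [DecidableEq m] [Fintype n]
    [DecidableEq n] (A : Matrix m n ℂ) {k : ℕ} (r : Fin k → m) (hr : Function.Injective r)
    (c : Fin k ≃ n) (S : Finset m) (hS : ∀ e, e ∈ S ↔ e ∈ Set.range r) :
    (Aᴴ * (diagonal (fun e => if e ∈ S then (1 : ℂ) else 0) * A)).det
      = ((‖(A.submatrix r c).det‖ ^ 2 : ℝ) : ℂ) := by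
  rw [← det_submatrix_equiv_self c]
  have : (Aᴴ * (diagonal (fun e => if e ∈ S then (1 : ℂ) else 0) * A)).submatrix c c
      = (A.submatrix r c)ᴴ * A.submatrix r c := by
    have hS' : S = univ.image r := by
      ext e
      rw [hS]
      simp
    have hD : diagonal (fun e => if e ∈ S then (1 : ℂ) else 0) * A
        = of fun e j => if e ∈ S then A e j else 0 := by
      ext e j
      simp [diagonal_mul]
    ext i j
    rw [hD, submatrix_apply, mul_apply, mul_apply]
    simp only [submatrix_apply, conjTranspose_apply, of_apply, mul_ite, mul_zero]
    rw [← Finset.sum_filter, Finset.filter_mem_eq_inter, Finset.univ_inter, hS',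
      sum_image (fun a _ b _ h => hr h)]
  rw [this, det_mul, det_conjTranspose]
  rw [RCLike.star_def, Complex.conj_mul']
  push_cast
  rfl

/-- A Gram determinant is the sum of the squares of the absolute values of the maximal minors. The
squared minor on a set `S` of rows is given by a function `t`, which is compared with the minors for
all enumerations of `S`. -/
theorem det_conjTranspose_mul_self_eq_sum {m n : Type*} [Fintype m] [DecidableEq m] [Fintype n]
    [DecidableEq n] (A : Matrix m n ℂ) (t : Finset m → ℝ)
    (ht : ∀ S : Finset m, ∀ r : Fin (Fintype.card n) → m, Function.Injective r →
      (S : Set m) = Set.range r → ∀ c : Fin (Fintype.card n) ≃ n,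
      ‖(A.submatrix r c).det‖ ^ 2 = t S) :
    (Aᴴ * A).det = ((∑ S ∈ powersetCard (Fintype.card n) (univ : Finset m), t S : ℝ) : ℂ) := by
  rw [det_mul_eq_sum_powersetCard]
  push_cast
  refine sum_congr rfl fun S hS => ?_
  have hcard := (mem_powersetCard.1 hS).2
  let r : Fin (Fintype.card n) → m := fun i => (S.equivFinOfCardEq hcard).symm i
  have hr : Function.Injective r := Subtype.val_injective.comp (Equiv.injective _)
  have hrS : (S : Set m) = Set.range r := by
    ext e
    constructor
    · intro he
      exact ⟨S.equivFinOfCardEq hcard ⟨e, he⟩, by simp [r]⟩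
    · rintro ⟨i, rfl⟩
      exact ((S.equivFinOfCardEq hcard).symm i).2
  have c : Fin (Fintype.card n) ≃ n := (Fintype.equivFin n).symm
  rw [det_conjTranspose_mul_diagonal_mul A r hr c S (fun e => by rw [← hrS]; rfl),
    ht S r hr hrS c]

/-- A rank one perturbation of a matrix with zero row and column sums. -/
theorem det_add_vecMulVec_of_sum_eq_zero {n R : Type*} [Fintype n] [DecidableEq n] [CommRing R]
    (L : Matrix n n R) (hrow : ∀ i, ∑ j, L i j = 0) (hcol : ∀ j, ∑ i, L i j = 0) (a b : n → R)
    (k : n) : (L + vecMulVec a b).det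
      = (∑ i, a i) * (∑ i, b i) * (L.submatrix (Subtype.val : {i // i ≠ k} → n) Subtype.val).det := by
  set s := ∑ i, a i
  set M := L + vecMulVec a b
  -- the sum of all the rows of `M` is `s • b`
  have h1 : M.det = s * (M.updateRow k b).det := by
    rw [← det_updateRow_smul]
    have := det_updateRow_sum M k (fun _ => 1)
    rw [one_smul] at this
    rw [← this]
    congr 2
    ext j
    have : (∑ i, (1 : R) • M i) j = ∑ i, M i j := by
      simp only [one_smul]
      exact Finset.sum_apply j univ fun i => M i
    rw [this]
    simp [M, vecMulVec_apply, sum_add_distrib, hcol, ← sum_mul, s]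
  -- subtract multiples of the row `b` from the other rows
  have h2 : (M.updateRow k b).det = (L.updateRow k b).det := by
    refine det_eq_of_forall_row_eq_smul_add_const (fun i => if i = k then 0 else a i) k (by simp) ?_
    intro i j
    by_cases h : i = k
    · subst h
      simp
    · simp [h, M, vecMulVec_apply]
  -- replace column `k` by the sum of all the columns
  have h3 : (L.updateRow k b).det
      = ((L.updateRow k b).updateCol k (Pi.single k (∑ i, b i))).det := by
    have := det_updateCol_sum (L.updateRow k b) k (fun _ => 1)
    rw [one_smul] at this
    rw [← this]
    congr 2
    ext i
    by_cases h : i = k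
    · subst h
      simp
    · simp [h, hrow]
  rw [h1, h2, h3, twoBlockTriangular_det _ (fun i => i = k)]
  · rw [mul_assoc]
    congr 2
    · trans ((L.updateRow k b).updateCol k (Pi.single k (∑ i, b i))) k k
      · convert det_eq_elem_of_subsingleton _ (⟨k, rfl⟩ : {i // i = k})
        rfl
      · simp
    · congr 1
      ext i j
      simp [toSquareBlockProp, i.2, j.2]
  · rintro i hi j rfl
    simp [hi]

/-- The determinant of a matrix whose entries vanish unless the two indices have the same image
under `b` is the product of the determinants of the diagonal blocks. -/
theorem det_eq_prod_toSquareBlock {n α R : Type*} [Fintype n] [DecidableEq n] [CommRing R]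
    [Fintype α] [DecidableEq α] (M : Matrix n n R) (b : n → α) (h : ∀ i j, b i ≠ b j → M i j = 0) :
    M.det = ∏ a, (M.toSquareBlock b a).det := by
  let o : LinearOrder α := LinearOrder.lift' (Fintype.equivFin α) (Equiv.injective _)
  have hM : M.BlockTriangular b := fun i j hij => h i j (ne_of_gt hij)
  convert hM.det_fintype

/-- Cofactor form of Cramer's rule for a vector whose image is supported at a single index. -/
theorem norm_det_mul_norm_eq {n : ℕ} (A : Matrix (Fin (n + 1)) (Fin (n + 1)) ℂ)
    (f : Fin (n + 1) → ℂ) (i j : Fin (n + 1)) (c : ℂ) (hf : A *ᵥ f = Pi.single i c) :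
    ‖A.det‖ * ‖f j‖ = ‖c‖ * ‖(A.submatrix i.succAbove j.succAbove).det‖ := by
  have h : (A.adjugate *ᵥ (A *ᵥ f)) j = A.det * f j := by
    rw [mulVec_mulVec, adjugate_mul, smul_mulVec, one_mulVec]
    rfl
  rw [hf, mulVec_single, Pi.smul_apply, col_apply, adjugate_fin_succ_eq_det_submatrix] at h
  rw [← norm_mul, ← h]
  simp [mul_comm]

end Matrix

theorem LinearIndepOn.finrank_span_image {α K E : Type*} [Field K] [AddCommGroup E] [Module K E]
    [Finite α] {φ : α → E} {S : Set α} (hS : LinearIndepOn K φ S) :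
    Module.finrank K (Submodule.span K (φ '' S)) = S.ncard := by
  have := Fintype.ofFinite S
  rw [Set.image_eq_range, finrank_span_eq_card hS, ← Nat.card_coe_set_eq,
    Nat.card_eq_fintype_card]

/-- The matroid of the linearly independent subfamilies of a finite family of vectors. -/
noncomputable def linearMatroid {α : Type*} (K : Type*) {E : Type*} [Field K] [AddCommGroup E]
    [Module K E] [Finite α] (φ : α → E) : Matroid α :=
  (IndepMatroid.ofFinite (Set.finite_univ (α := α)) (LinearIndepOn K φ)
    (linearIndepOn_empty K φ) (fun _ _ hJ h => hJ.mono h)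
    (by
      intro I J hI hJ hlt
      by_contra! hcon
      have hJI : φ '' J ⊆ Submodule.span K (φ '' I) := by
        rintro _ ⟨e, he, rfl⟩
        by_cases heI : e ∈ I
        · exact Submodule.subset_span ⟨e, heI, rfl⟩
        · by_contra hns
          exact hcon e he heI (hI.insert hns)
      have hle : Submodule.span K (φ '' J) ≤ Submodule.span K (φ '' I) :=
        Submodule.span_le.2 hJI
      have : Module.Finite K (Submodule.span K (φ '' I)) :=
        Module.Finite.span_of_finite K (Set.toFinite _)
      have h1 := Submodule.finrank_mono hle
      rw [hI.finrank_span_image, hJ.finrank_span_image] at h1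
      omega)
    (fun _ _ => Set.subset_univ _)).matroid

theorem linearMatroid_indep {α K E : Type*} [Field K] [AddCommGroup E] [Module K E] [Finite α]
    (φ : α → E) (F : Set α) : (linearMatroid K φ).Indep F ↔ LinearIndepOn K φ F :=
  Iff.rfl

theorem linearMatroid_isBase {α K E : Type*} [Field K] [AddCommGroup E] [Module K E] [Finite α]
    [Module.Finite K E] (φ : α → E) (hφ : Submodule.span K (Set.range φ) = ⊤) (F : Set α) :
    (linearMatroid K φ).IsBase F ↔ LinearIndepOn K φ F ∧ F.ncard = Module.finrank K E := by
  rw [Matroid.isBase_iff_maximal_indep, maximal_iff]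
  simp only [linearMatroid_indep]
  constructor
  · rintro ⟨hF, hmax⟩
    refine ⟨hF, ?_⟩
    have : Submodule.span K (φ '' F) = ⊤ := by
      rw [eq_top_iff, ← hφ, Submodule.span_le]
      rintro _ ⟨e, rfl⟩
      by_contra hns
      have heF : e ∉ F := fun he => hns (Submodule.subset_span ⟨e, he, rfl⟩)
      have h := hmax (hF.insert hns) (Set.subset_insert _ _)
      exact heF (h ▸ Set.mem_insert e F)
    rw [← hF.finrank_span_image, this, finrank_top]
  · rintro ⟨hF, hc⟩
    refine ⟨hF, fun J hJ hFJ => Set.eq_of_subset_of_ncard_le hFJ ?_ (Set.toFinite J)⟩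
    rw [hc, ← hJ.finrank_span_image]
    exact Submodule.finrank_le _

/-- The dual of the matroid of the rows of a matrix `A` is realized by the images of the standard
basis vectors in the cokernel of `A`. -/
noncomputable def cokernelMatroid {E n : Type*} [Finite E] [DecidableEq E] [Fintype n]
    (A : Matrix E n ℂ) : Matroid E :=
  linearMatroid ℂ fun e : E =>
    (Submodule.mkQ (LinearMap.range A.mulVecLin)) (Pi.single e (1 : ℂ))

theorem cokernelMatroid_indep {E n : Type*} [Fintype E] [DecidableEq E] [Fintype n]
    (A : Matrix E n ℂ) (F : Set E) : (cokernelMatroid A).Indep F ↔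
      ∀ f, (∀ e, e ∉ F → A.mulVec f e = 0) → A.mulVec f = 0 := by
  classical
  have hsum : ∀ c : E → ℂ, ∑ e, c e • (Pi.single e (1 : ℂ) : E → ℂ) = c := by
    intro c
    ext e
    simp [Finset.sum_apply, Pi.single_apply]
  rw [cokernelMatroid, linearMatroid_indep, linearIndepOn_iff']
  constructor
  · intro h f hf
    have h0 := h (Finset.univ.filter (· ∈ F)) (A.mulVec f) (by intro x; simp) (by
      rw [Finset.sum_filter_of_ne]
      · simp_rw [← map_smul, ← map_sum, hsum]
        exact (Submodule.Quotient.mk_eq_zero _).2 ⟨f, rfl⟩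
      · intro e _ hne
        by_contra heF
        rw [hf e heF, zero_smul] at hne
        exact hne rfl)
    ext e
    by_cases he : e ∈ F
    · exact h0 e (by simpa using he)
    · exact hf e he
  · intro h t c htF hc e he
    have h1 : ∑ e ∈ t, c e • (Pi.single e (1 : ℂ) : E → ℂ) = fun e => if e ∈ t then c e else 0 := by
      rw [← hsum (fun e => if e ∈ t then c e else 0)]
      simp [Finset.sum_ite_mem]
    simp_rw [← map_smul, ← map_sum, h1] at hc
    obtain ⟨f, hf⟩ := (Submodule.Quotient.mk_eq_zero _).1 hc
    have hf' : A.mulVec f = fun e => if e ∈ t then c e else 0 := hf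
    have h2 := h f (fun e he => by
      rw [hf']
      have : e ∉ t := fun h => he (htF h)
      simp [this])
    rw [hf'] at h2
    have := congrFun h2 e
    simpa [he] using this

theorem cokernelMatroid_isBase {E n : Type*} [Fintype E] [DecidableEq E] [Fintype n]
    (A : Matrix E n ℂ) (hA : ∀ f, A.mulVec f = 0 → f = 0) (F : Set E) :
    (cokernelMatroid A).IsBase F ↔
      (∀ f, (∀ e, e ∉ F → A.mulVec f e = 0) → f = 0) ∧ F.ncard + Fintype.card n = Fintype.card E := by
  have hspan : Submodule.span ℂ (Set.range fun e : E =>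
      (Submodule.mkQ (LinearMap.range A.mulVecLin)) (Pi.single e (1 : ℂ))) = ⊤ := by
    have h1 : Submodule.span ℂ (Set.range fun e : E => (Pi.single e (1 : ℂ) : E → ℂ)) = ⊤ := by
      rw [← (Pi.basisFun ℂ E).span_eq]
      congr 2
      ext e
      simp
    rw [show (fun e : E => (Submodule.mkQ (LinearMap.range A.mulVecLin)) (Pi.single e (1 : ℂ)))
      = (Submodule.mkQ (LinearMap.range A.mulVecLin)) ∘ fun e : E => Pi.single e (1 : ℂ) from rfl,
      Set.range_comp, Submodule.span_image, h1, Submodule.map_top, Submodule.range_mkQ]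
  have hrk := Submodule.finrank_quotient_add_finrank (LinearMap.range A.mulVecLin)
  rw [LinearMap.finrank_range_of_inj, Module.finrank_fintype_fun_eq_card,
    Module.finrank_fintype_fun_eq_card] at hrk
  · have hb := linearMatroid_isBase _ hspan F
    have hi := cokernelMatroid_indep A F
    rw [cokernelMatroid, linearMatroid_indep] at hi
    rw [cokernelMatroid, hb, hi, ← hrk]
    refine and_congr (forall_congr' fun f => imp_congr_right fun _ => ⟨hA f, ?_⟩) (by omega)
    rintro rfl
    exact A.mulVec_zero
  · rw [← LinearMap.ker_eq_bot, LinearMap.ker_eq_bot']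
    exact hA

open Matrix in
/-- The order of the cokernel of an integral square matrix. When the determinant vanishes the
cokernel is infinite, and `Nat.card` is zero too. -/
theorem card_quotient_range_mulVecLin {n : Type*} [Fintype n] [DecidableEq n] (A : Matrix n n ℤ) :
    Nat.card ((n → ℤ) ⧸ LinearMap.range A.mulVecLin) = A.det.natAbs := by
  by_cases h : A.det = 0
  · rw [h, Int.natAbs_zero]
    by_contra hc
    have : Finite ((n → ℤ) ⧸ LinearMap.range A.mulVecLin) := Nat.finite_of_card_ne_zero hc
    -- a vector killed by `A` from the left distinguishes infinitely many classes
    obtain ⟨v, hv, hvA⟩ := Matrix.exists_vecMul_eq_zero_iff.2 h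
    obtain ⟨i, hi⟩ : ∃ i, v i ≠ 0 := by
      by_contra! h0
      exact hv (funext h0)
    let ψ : (n → ℤ) →ₗ[ℤ] ℤ := ∑ j, v j • LinearMap.proj j
    have hψ_apply : ∀ f, ψ f = v ⬝ᵥ f := fun f => by simp [ψ, dotProduct]
    have hψ : LinearMap.range A.mulVecLin ≤ LinearMap.ker ψ := by
      rintro _ ⟨f, rfl⟩
      simp [hψ_apply, Matrix.dotProduct_mulVec, hvA]
    let ψ' := (LinearMap.range A.mulVecLin).liftQ ψ hψ
    have hinj : Function.Injective
        fun k : ℤ => (LinearMap.range A.mulVecLin).mkQ (Pi.single i k) := by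
      intro a b hab
      have := congrArg ψ' hab
      simpa [ψ', hψ_apply, hi] using this
    exact not_finite_iff_infinite.2 (Infinite.of_injective _ hinj) this
  · have hinj : Function.Injective A.mulVecLin := Matrix.mulVec_injective_of_det_ne_zero h
    let e : (n → ℤ) ≃ₗ[ℤ] LinearMap.range A.mulVecLin := LinearEquiv.ofInjective _ hinj
    rw [← Submodule.natAbs_det_equiv _ e]
    congr 1
    rw [← LinearMap.det_toLin' A]
    rfl

/-! ### Reachability and cycles in Serre graphs -/

namespace SerreGraph

variable {V H : Type*} (X : SerreGraph V H)

theorem edge_eq_edge_iff {a b : H} : X.edge a = X.edge b ↔ a = b ∨ a = X.bar b :=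
  Quotient.eq

theorem edge_bar (h : H) : X.edge (X.bar h) = X.edge h :=
  X.edge_eq_edge_iff.2 (Or.inr rfl)

theorem edge_out (e : X.Edge) : X.edge (Quotient.out e) = e :=
  Quotient.out_eq e

theorem adjGraph_adj {S : Set X.Edge} {u v : V} : (X.adjGraph S).Adj u v ↔
    u ≠ v ∧ ∃ h, X.edge h ∈ S ∧ X.root h = u ∧ X.root (X.bar h) = v := by
  rw [adjGraph, SimpleGraph.fromRel_adj]
  refine and_congr_right fun _ => ⟨?_, Or.inl⟩
  rintro (h | ⟨h, hS, hv, hu⟩)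
  · exact h
  · exact ⟨X.bar h, by rwa [edge_bar], hu, by rw [X.bar_bar, hv]⟩

variable {X}

theorem reachable_root_bar {S : Set X.Edge} {h : H} (hS : X.edge h ∈ S) :
    (X.adjGraph S).Reachable (X.root h) (X.root (X.bar h)) := by
  by_cases heq : X.root h = X.root (X.bar h)
  · rw [heq]
  · exact (X.adjGraph_adj.2 ⟨heq, h, hS, rfl, rfl⟩).reachable

/-- A property that propagates along the edges in `S` propagates to connected components. -/
theorem reachable_induction {S : Set X.Edge} {P : V → Prop}
    (hP : ∀ h, X.edge h ∈ S → P (X.root h) → P (X.root (X.bar h))) {a b : V}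
    (hab : (X.adjGraph S).Reachable a b) (ha : P a) : P b := by
  obtain ⟨w⟩ := hab
  induction w with
  | nil => exact ha
  | cons hadj _ ih =>
    obtain ⟨-, h, hS, rfl, rfl⟩ := X.adjGraph_adj.1 hadj
    exact ih (hP h hS ha)

theorem adjGraph_mono {S T : Set X.Edge} (h : S ⊆ T) : X.adjGraph S ≤ X.adjGraph T := by
  intro u v huv
  obtain ⟨hne, k, hk, h1, h2⟩ := X.adjGraph_adj.1 huv
  exact X.adjGraph_adj.2 ⟨hne, k, h hk, h1, h2⟩

/-- Removing an edge whose endpoints remain connected does not change reachability. -/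
theorem reachable_diff_iff {S : Set X.Edge} {h : H}
    (hh : (X.adjGraph (S \ {X.edge h})).Reachable (X.root h) (X.root (X.bar h))) {a b : V} :
    (X.adjGraph (S \ {X.edge h})).Reachable a b ↔ (X.adjGraph S).Reachable a b := by
  refine ⟨fun hr => hr.mono (adjGraph_mono Set.sdiff_subset), fun hr => ?_⟩
  refine reachable_induction (P := fun v => (X.adjGraph (S \ {X.edge h})).Reachable a v)
    (fun k hk ha => ha.trans ?_) hr SimpleGraph.Reachable.rfl
  by_cases hke : X.edge k = X.edge h
  · rcases X.edge_eq_edge_iff.1 hke with rfl | rfl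
    · exact hh
    · rw [X.bar_bar]
      exact hh.symm
  · exact reachable_root_bar ⟨hk, hke⟩

section Cycle

variable {n : ℕ} {γ : Fin (n + 1) → H}

theorem IsCycle.root_bar_ofNat (hγ : X.IsCycle γ) (k : ℕ) :
    X.root (X.bar (γ (Fin.ofNat (n + 1) k))) = X.root (γ (Fin.ofNat (n + 1) (k + 1))) := by
  rw [hγ.1]
  congr 2
  ext
  simp [Fin.val_add]

theorem IsCycle.edge_ofNat_ne (hγ : X.IsCycle γ) {k : ℕ} (hk : k < n) :
    X.edge (γ (Fin.ofNat (n + 1) (k + 1))) ≠ X.edge (γ 0) := by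
  intro h
  have h0 := congrArg Fin.val (hγ.2.2 h)
  rw [Fin.val_ofNat, Nat.mod_eq_of_lt (by omega)] at h0
  simp at h0

/-- A function that is flat for the transport `u` along the edges of a cycle other than the edge of
`γ 0` is transported around the cycle. -/
theorem IsCycle.transport (hγ : X.IsCycle γ) (u f : _ → ℂ)
    (hf : ∀ i, X.edge (γ i) ≠ X.edge (γ 0) → f (X.root (γ i)) = u (γ i) * f (X.root (X.bar (γ i)))) :
    u (γ 0) * f (X.root (X.bar (γ 0))) = (∏ i, u (γ i)) * f (X.root (γ 0)) := by
  have key : ∀ k ≤ n, f (X.root (X.bar (γ 0))) =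
      (∏ j ∈ Finset.range k, u (γ (Fin.ofNat (n + 1) (j + 1)))) *
        f (X.root (γ (Fin.ofNat (n + 1) (k + 1)))) := by
    intro k
    induction k with
    | zero =>
      intro _
      have := hγ.root_bar_ofNat 0
      rw [show Fin.ofNat (n + 1) 0 = 0 from rfl] at this
      rw [this]
      simp
    | succ k ih =>
      intro hk
      rw [ih (by omega), Finset.prod_range_succ, mul_assoc,
        hf _ (hγ.edge_ofNat_ne (k := k) (by omega)), hγ.root_bar_ofNat]
  rw [key n le_rfl, Finset.prod_range, Fin.prod_univ_succ, mul_assoc]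
  congr 2
  · refine Finset.prod_congr rfl fun i _ => ?_
    congr 2
    ext
    simp
  · simp

theorem IsCycle.reachable_diff (hγ : X.IsCycle γ) {S : Set X.Edge} (hS : ∀ i, X.edge (γ i) ∈ S) :
    (X.adjGraph (S \ {X.edge (γ 0)})).Reachable (X.root (γ 0)) (X.root (X.bar (γ 0))) := by
  have key : ∀ k ≤ n, (X.adjGraph (S \ {X.edge (γ 0)})).Reachable (X.root (X.bar (γ 0)))
        (X.root (γ (Fin.ofNat (n + 1) (k + 1)))) := by
    intro k
    induction k with
    | zero =>
      intro _
      have := hγ.root_bar_ofNat 0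
      rw [show Fin.ofNat (n + 1) 0 = 0 from rfl] at this
      rw [this]
    | succ k ih =>
      intro hk
      refine (ih (by omega)).trans ?_
      rw [← hγ.root_bar_ofNat (k + 1)]
      exact reachable_root_bar ⟨hS _, hγ.edge_ofNat_ne (by omega)⟩
  have := key n le_rfl
  rw [show Fin.ofNat (n + 1) (n + 1) = 0 from Fin.ext (by simp)] at this
  exact this.symm

end Cycle

/-- An edge outside `S` whose endpoints are connected in `S` closes a cycle. -/
theorem exists_isCycle_of_reachable {S : Set X.Edge} {h : H} (hS : X.edge h ∉ S)
    (hr : (X.adjGraph S).Reachable (X.root h) (X.root (X.bar h))) :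
    ∃ (n : ℕ) (γ : Fin (n + 1) → H), X.IsCycle γ ∧ ∀ i, X.edge (γ i) ∈ insert (X.edge h) S := by
  obtain ⟨p, hp⟩ := hr.symm.exists_isPath
  have hadj : ∀ i : Fin (p.length + 1), i.val < p.length →
      ∃ k, X.edge k ∈ S ∧ X.root k = p.getVert i ∧ X.root (X.bar k) = p.getVert (i + 1) :=
    fun i hi => (X.adjGraph_adj.1 (p.adj_getVert_succ hi)).2
  have : Nonempty H := ⟨h⟩
  choose! g hgS hg1 hg2 using hadj
  let γ : Fin (p.length + 1) → H := fun i => if i.val < p.length then g i else h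
  have hlast : ∀ i : Fin (p.length + 1), ¬ i.val < p.length → i = Fin.last _ := by
    intro i hi
    ext
    simp only [Fin.val_last]
    omega
  have hγS : ∀ i : Fin (p.length + 1), i.val < p.length → X.edge (γ i) ∈ S := by
    intro i hi
    simp only [γ, if_pos hi]
    exact hgS i hi
  have hγh : ∀ i : Fin (p.length + 1), ¬ i.val < p.length → γ i = h := by
    intro i hi
    simp only [γ, if_neg hi]
  have hroot : ∀ i, X.root (γ i) = p.getVert i := by
    intro i
    by_cases hi : i.val < p.length
    · simp only [γ, if_pos hi]
      exact hg1 i hi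
    · rw [hγh i hi, hlast i hi, Fin.val_last, p.getVert_length]
  have hinj : Function.Injective fun i => X.root (γ i) := by
    intro i j hij
    simp only [hroot] at hij
    exact Fin.ext (hp.getVert_injOn (Nat.lt_succ_iff.1 i.2) (Nat.lt_succ_iff.1 j.2) hij)
  have hnext : ∀ i, X.root (X.bar (γ i)) = X.root (γ (i + 1)) := by
    intro i
    rw [hroot]
    by_cases hi : i.val < p.length
    · rw [Fin.val_add_one_of_lt (Fin.lt_def.2 hi)]
      simp only [γ, if_pos hi]
      exact hg2 i hi
    · rw [hγh i hi, hlast i hi, Fin.last_add_one]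
      simp
  refine ⟨p.length, γ, ⟨hnext, hinj, fun i j hij => ?_⟩, fun i => ?_⟩
  · simp only at hij
    by_cases hi : i.val < p.length
    · by_cases hj : j.val < p.length
      · rcases X.edge_eq_edge_iff.1 hij with h1 | h1
        · exact hinj (congrArg X.root h1)
        · -- traversing one edge in both directions would need `i = j + 1` and `j = i + 1`
          have h2 : i = j + 1 := hinj (by simp only [h1, hnext])
          have h3 : j = i + 1 := hinj (by simp only [← hnext, h1, X.bar_bar])
          have h4 := Fin.val_add_one_of_lt (Fin.lt_def.2 hi)
          have h5 := Fin.val_add_one_of_lt (Fin.lt_def.2 hj)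
          rw [← h3] at h4
          rw [← h2] at h5
          omega
      · exact absurd (hγS i hi) (by rw [hij, hγh j hj]; exact hS)
    · by_cases hj : j.val < p.length
      · exact absurd (hγS j hj) (by rw [← hij, hγh i hi]; exact hS)
      · rw [hlast i hi, hlast j hj]
  · by_cases hi : i.val < p.length
    · exact Or.inr (hγS i hi)
    · exact Or.inl (by rw [hγh i hi])

/-- Every edge of an acyclic set of edges is a bridge. -/
theorem not_reachable_of_acyclic {S : Set X.Edge}
    (hS : ∀ (n : ℕ) (γ : Fin (n + 1) → H), X.IsCycle γ → ¬ ∀ i, X.edge (γ i) ∈ S) {h : H}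
    (hh : X.edge h ∈ S) :
    ¬ (X.adjGraph (S \ {X.edge h})).Reachable (X.root h) (X.root (X.bar h)) := by
  intro hr
  obtain ⟨n, γ, hγ, hγS⟩ := exists_isCycle_of_reachable (by simp) hr
  refine hS n γ hγ fun i => ?_
  rcases hγS i with h1 | h1
  · rwa [h1]
  · exact h1.1

end SerreGraph

/-! ### Minors of the twisted incidence matrix -/

namespace Matrix

variable {E V : Type*} {n : ℕ} (A : Matrix E V ℂ)

theorem mulVec_submatrix_comp {ι κ : Type*} [Fintype V] [Fintype κ] (r : ι → E) {c : κ → V}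
    (hc : Function.Injective c) {F : V → ℂ} (hF : ∀ v, v ∉ Set.range c → F v = 0) :
    (A.submatrix r c).mulVec (F ∘ c) = A.mulVec F ∘ r := by
  ext i
  simp only [mulVec, dotProduct, submatrix_apply, Function.comp_apply]
  exact Fintype.sum_of_injective c hc _ _ (fun v hv => by rw [hF v hv, mul_zero]) fun _ => rfl

variable {A} {r : Fin n → E} {c : Fin n → V}

theorem injective_rows_of_det_ne_zero (h : (A.submatrix r c).det ≠ 0) : Function.Injective r := by
  intro i j hij
  by_contra hne
  exact h (det_zero_of_row_eq hne (by ext k; simp [hij]))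

theorem injective_cols_of_det_ne_zero (h : (A.submatrix r c).det ≠ 0) : Function.Injective c := by
  intro i j hij
  by_contra hne
  exact h (det_zero_of_column_eq hne (by simp [hij]))

theorem exists_mulVec_comp_eq_single [Fintype V] (h : (A.submatrix r c).det ≠ 0) (i : Fin n) :
    ∃ F : V → ℂ, (∀ v, v ∉ Set.range c → F v = 0) ∧ A.mulVec F ∘ r = Pi.single i 1 := by
  have hc := injective_cols_of_det_ne_zero h
  refine ⟨Function.extend c ((A.submatrix r c)⁻¹.mulVec (Pi.single i 1)) 0, fun v hv => ?_, ?_⟩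
  · exact Function.extend_apply' _ _ _ hv
  · rw [← mulVec_submatrix_comp A r hc (fun v hv => by exact Function.extend_apply' _ _ _ hv),
      Function.extend_comp hc, mulVec_mulVec, mul_nonsing_inv _ (isUnit_iff_ne_zero.2 h),
      one_mulVec]

/-- Expansion of a minor along a vector whose image is supported in one row. -/
theorem norm_det_submatrix_mul_norm_eq [Fintype V] {r : Fin (n + 1) → E} {c : Fin (n + 1) → V}
    (hc : Function.Injective c) {F : V → ℂ} (hF : ∀ v, v ∉ Set.range c → F v = 0)
    {i : Fin (n + 1)} {a : ℂ} (hA : A.mulVec F ∘ r = Pi.single i a) (j : Fin (n + 1)) :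
    ‖(A.submatrix r c).det‖ * ‖F (c j)‖
      = ‖a‖ * ‖(A.submatrix (r ∘ i.succAbove) (c ∘ j.succAbove)).det‖ :=
  norm_det_mul_norm_eq (A.submatrix r c) (F ∘ c) i j a
    (by rw [mulVec_submatrix_comp A r hc hF, hA])

end Matrix

theorem Fin.range_comp_succAbove {n : ℕ} {E : Type*} {r : Fin (n + 1) → E}
    (hr : Function.Injective r) (i : Fin (n + 1)) :
    Set.range (r ∘ i.succAbove) = Set.range r \ {r i} := by
  rw [Set.range_comp, Fin.range_succAbove, Set.image_compl_eq_range_sdiff_image hr,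
    Set.image_singleton]

namespace SerreGraph

variable {V H : Type*} (X : SerreGraph V H)

open scoped Classical in
/-- The matrix of the twisted coboundary: it sends a function `f` on the vertices to the function
`e ↦ f (root h) - u h * f (root (bar h))` on the edges, where `h` is a chosen orientation of `e`. -/
noncomputable def twistedIncidence (u : H → ℂ) : Matrix X.Edge V ℂ :=
  Matrix.of fun e v => (if X.root (Quotient.out e) = v then 1 else 0)
    - u (Quotient.out e) * (if X.root (X.bar (Quotient.out e)) = v then 1 else 0)

variable {X} {u : H → ℂ}

/-- A flat function that does not vanish at a vertex does not vanish on its component. -/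
theorem ne_zero_of_reachable {S : Set X.Edge} {f : V → ℂ}
    (hf : ∀ h, X.edge h ∈ S → f (X.root h) = u h * f (X.root (X.bar h))) {a b : V}
    (hab : (X.adjGraph S).Reachable a b) (ha : f a ≠ 0) : f b ≠ 0 := by
  refine reachable_induction (P := fun v => f v ≠ 0) (fun h hS h0 h1 => h0 ?_) hab ha
  rw [hf h hS, h1, mul_zero]

variable [Fintype V]

theorem twistedIncidence_mulVec (f : V → ℂ) (e : X.Edge) :
    (X.twistedIncidence u).mulVec f e = f (X.root (Quotient.out e))
      - u (Quotient.out e) * f (X.root (X.bar (Quotient.out e))) := by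
  classical
  simp [twistedIncidence, Matrix.mulVec, dotProduct, sub_mul, Finset.sum_sub_distrib]

/-- Vanishing of the coboundary on an edge does not depend on the orientation. -/
theorem twistedIncidence_mulVec_eq_zero_iff (hu : ∀ h, u (X.bar h) * u h = 1) (f : V → ℂ) (h : H) :
    (X.twistedIncidence u).mulVec f (X.edge h) = 0 ↔
      f (X.root h) = u h * f (X.root (X.bar h)) := by
  rw [twistedIncidence_mulVec, sub_eq_zero]
  rcases X.edge_eq_edge_iff.1 (X.edge_out (X.edge h)) with h1 | h1
  · rw [h1]
  · rw [h1, X.bar_bar]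
    constructor
    · intro h2
      rw [h2, ← mul_assoc, mul_comm (u h), hu, one_mul]
    · intro h2
      rw [h2, ← mul_assoc, hu, one_mul]

/-- The absolute value of the coboundary on an edge does not depend on the orientation. -/
theorem norm_twistedIncidence_mulVec (hu : ∀ h, u (X.bar h) * u h = 1) (hu1 : ∀ h, ‖u h‖ = 1)
    (f : V → ℂ) (h : H) : ‖(X.twistedIncidence u).mulVec f (X.edge h)‖ =
      ‖f (X.root h) - u h * f (X.root (X.bar h))‖ := by
  rw [twistedIncidence_mulVec]
  rcases X.edge_eq_edge_iff.1 (X.edge_out (X.edge h)) with h1 | h1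
  · rw [h1]
  · rw [h1, X.bar_bar, ← one_mul ‖f (X.root h) - _‖, ← hu1 (X.bar h), ← norm_mul, mul_sub,
      ← mul_assoc, hu, one_mul, norm_sub_rev]

variable {n : ℕ}

/-- Solutions of the coboundary equation supported at the row `i` are flat on the other rows. -/
theorem flat_of_mulVec_comp_eq_single (hu : ∀ h, u (X.bar h) * u h = 1) {r : Fin n → X.Edge}
    {F : V → ℂ} {i : Fin n} {a : ℂ}
    (hF : (X.twistedIncidence u).mulVec F ∘ r = Pi.single i a) {h : H}
    (hh : X.edge h ∈ Set.range r \ {r i}) : F (X.root h) = u h * F (X.root (X.bar h)) := by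
  obtain ⟨⟨j, hj⟩, hne⟩ := hh
  rw [← twistedIncidence_mulVec_eq_zero_iff hu, ← hj]
  have := congrFun hF j
  rwa [Pi.single_eq_of_ne] at this
  rintro rfl
  exact hne hj.symm

/-- A nonzero minor of the incidence matrix whose edges form a forest has absolute value one. -/
theorem norm_det_eq_one_of_acyclic (hu : ∀ h, u (X.bar h) * u h = 1) (hu1 : ∀ h, ‖u h‖ = 1)
    (r : Fin n → X.Edge) (c : Fin n → V)
    (hr : ∀ (m : ℕ) (γ : Fin (m + 1) → H), X.IsCycle γ → ¬ ∀ i, X.edge (γ i) ∈ Set.range r)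
    (hdet : ((X.twistedIncidence u).submatrix r c).det ≠ 0) :
    ‖((X.twistedIncidence u).submatrix r c).det‖ = 1 := by
  induction n with
  | zero => simp
  | succ n ih =>
    have hrinj := Matrix.injective_rows_of_det_ne_zero hdet
    have hcinj := Matrix.injective_cols_of_det_ne_zero hdet
    obtain ⟨F, hF, hAF⟩ := Matrix.exists_mulVec_comp_eq_single hdet 0
    have hstep : ∃ j : Fin (n + 1), ‖((X.twistedIncidence u).submatrix r c).det‖
        = ‖((X.twistedIncidence u).submatrix (r ∘ Fin.succAbove 0) (c ∘ j.succAbove)).det‖ := by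
      set h : H := Quotient.out (r 0) with hdef
      have hh : X.edge h = r 0 := X.edge_out _
      have hF0 : F (X.root h) - u h * F (X.root (X.bar h)) = 1 := by
        have := congrFun hAF 0
        rwa [Pi.single_eq_same, Function.comp_apply, twistedIncidence_mulVec] at this
      have hbr := not_reachable_of_acyclic hr (h := h) (hh ▸ Set.mem_range_self 0)
      by_cases hs : F (X.root h) = 0
      · -- here only the target of `h` carries a nonzero value
        have ht : ‖F (X.root (X.bar h))‖ = 1 := by
          rw [hs, zero_sub] at hF0
          have := congrArg norm hF0
          rwa [norm_neg, norm_mul, hu1, one_mul, norm_one] at this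
        obtain ⟨j, hj⟩ : X.root (X.bar h) ∈ Set.range c := by
          by_contra hc
          rw [hF _ hc, norm_zero] at ht
          exact zero_ne_one ht
        have := Matrix.norm_det_submatrix_mul_norm_eq hcinj hF hAF j
        rw [hj, ht, norm_one, mul_one, one_mul] at this
        exact ⟨j, this⟩
      · obtain ⟨j, hj⟩ : X.root h ∈ Set.range c := by
          by_contra hc
          exact hs (hF _ hc)
        refine ⟨j, ?_⟩
        -- restrict `F` to the component of the source of `h` in the forest without `h`
        classical
        let F' : V → ℂ := fun v =>
          if (X.adjGraph (Set.range r \ {X.edge h})).Reachable (X.root h) v then F v else 0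
        have hF' : ∀ v, v ∉ Set.range c → F' v = 0 := by
          intro v hv
          simp [F', hF v hv]
        have hAF' : (X.twistedIncidence u).mulVec F' ∘ r = Pi.single 0 (F (X.root h)) := by
          ext i
          by_cases hi : i = 0
          · subst hi
            rw [Pi.single_eq_same, Function.comp_apply, twistedIncidence_mulVec, ← hdef]
            simp only [F']
            rw [if_pos SimpleGraph.Reachable.rfl, if_neg hbr, mul_zero, sub_zero]
          · rw [Pi.single_eq_of_ne hi, Function.comp_apply, ← X.edge_out (r i),
              twistedIncidence_mulVec_eq_zero_iff hu]
            set k : H := Quotient.out (r i)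
            have hk : X.edge k ∈ Set.range r \ {X.edge h} := by
              refine ⟨⟨i, (X.edge_out _).symm⟩, ?_⟩
              rw [hh, X.edge_out (r i)]
              exact fun h' => hi (hrinj h')
            have hflat := flat_of_mulVec_comp_eq_single hu hAF (h := k) (by rwa [← hh])
            have hk' := reachable_root_bar hk
            simp only [F']
            by_cases hr1 : (X.adjGraph (Set.range r \ {X.edge h})).Reachable (X.root h) (X.root k)
            · rw [if_pos hr1, if_pos (hr1.trans hk'), hflat]
            · rw [if_neg hr1, if_neg fun hr2 => hr1 (hr2.trans hk'.symm), mul_zero]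
        have := Matrix.norm_det_submatrix_mul_norm_eq hcinj hF' hAF' j
        have hF'j : F' (c j) = F (X.root h) := by
          rw [hj]
          simp only [F']
          rw [if_pos SimpleGraph.Reachable.rfl]
        rw [hF'j, mul_comm] at this
        exact mul_left_cancel₀ (norm_ne_zero_iff.2 hs) this
    obtain ⟨j, hj⟩ := hstep
    rw [hj]
    refine ih _ _ (fun m γ hγ hS => hr m γ hγ fun i => ?_) ?_
    · rw [Fin.range_comp_succAbove hrinj] at hS
      exact (hS i).1
    · rw [← norm_ne_zero_iff, ← hj]
      exact norm_ne_zero_iff.2 hdet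

/-- If the edges of a nonzero minor contain a cycle, then all the vertices of the component of the
cycle index columns of the minor, and expanding along an edge of the cycle splits off the factor
`1 - u(γ)`, where `u(γ)` is the holonomy of the cycle. -/
theorem exists_norm_det_eq_of_isCycle (hu : ∀ h, u (X.bar h) * u h = 1) (hu1 : ∀ h, ‖u h‖ = 1)
    (r : Fin (n + 1) → X.Edge) (c : Fin (n + 1) → V)
    (hdet : ((X.twistedIncidence u).submatrix r c).det ≠ 0) {m : ℕ} {γ : Fin (m + 1) → H}
    (hγ : X.IsCycle γ) (hS : ∀ i, X.edge (γ i) ∈ Set.range r) :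
    (∀ v, (X.adjGraph (Set.range r)).Reachable (X.root (γ 0)) v → v ∈ Set.range c) ∧
    ∃ i j, r i = X.edge (γ 0) ∧ c j = X.root (γ 0) ∧
      ‖((X.twistedIncidence u).submatrix r c).det‖ = ‖1 - ∏ k, u (γ k)‖ *
        ‖((X.twistedIncidence u).submatrix (r ∘ i.succAbove) (c ∘ j.succAbove)).det‖ := by
  have hcinj := Matrix.injective_cols_of_det_ne_zero hdet
  obtain ⟨i, hi⟩ := hS 0
  obtain ⟨F, hF, hAF⟩ := Matrix.exists_mulVec_comp_eq_single hdet i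
  have hflat : ∀ h, X.edge h ∈ Set.range r \ {X.edge (γ 0)} →
      F (X.root h) = u h * F (X.root (X.bar h)) := fun h hh =>
    flat_of_mulVec_comp_eq_single hu hAF (h := h) (by rwa [hi])
  have htr := hγ.transport u F fun k hk => hflat _ ⟨hS k, hk⟩
  have hAi : (X.twistedIncidence u).mulVec F (X.edge (γ 0)) ≠ 0 := by
    have := congrFun hAF i
    rw [Pi.single_eq_same, Function.comp_apply, hi] at this
    rw [this]
    exact one_ne_zero
  have hne : F (X.root (γ 0)) ≠ 0 := by
    intro h0
    rw [h0, mul_zero] at htr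
    exact hAi ((twistedIncidence_mulVec_eq_zero_iff hu F _).2 (by rw [h0, htr]))
  have hsupp : ∀ v, F v ≠ 0 → v ∈ Set.range c := fun v hv => by
    by_contra hc
    exact hv (hF v hc)
  refine ⟨fun v hv => hsupp v ?_, ?_⟩
  · rw [← reachable_diff_iff (hγ.reachable_diff hS)] at hv
    exact ne_zero_of_reachable hflat hv hne
  · obtain ⟨j, hj⟩ := hsupp _ hne
    refine ⟨i, j, hi, hj, ?_⟩
    have hexp := Matrix.norm_det_submatrix_mul_norm_eq hcinj hF hAF j
    rw [hj, norm_one, one_mul] at hexp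
    have hhol : ‖1 - ∏ k, u (γ k)‖ * ‖F (X.root (γ 0))‖ = 1 := by
      rw [← norm_mul, sub_mul, one_mul, ← htr]
      rw [← norm_twistedIncidence_mulVec hu hu1, ← hi]
      have := congrFun hAF i
      rw [Pi.single_eq_same, Function.comp_apply] at this
      rw [this, norm_one]
    rw [← hexp]
    rw [mul_left_comm, hhol, mul_one]

/-- The absolute value of a nonzero minor of the incidence matrix is the product of the weights of
the components of the graph formed by its edges: a component with a cycle contributes the absolute
value of `1` minus the holonomy of the cycle, and a tree contributes `1`. The components are indexed
by the values of `q`, so that they can be kept fixed while edges of cycles are removed. -/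
theorem norm_det_eq_prod_weight (hu : ∀ h, u (X.bar h) * u h = 1) (hu1 : ∀ h, ‖u h‖ = 1)
    {Q : Type*} [Fintype Q] (q : V → Q) (w : Q → ℝ) (r : Fin n → X.Edge) (c : Fin n → V)
    (hq : ∀ a b, q a = q b ↔ (X.adjGraph (Set.range r)).Reachable a b)
    (hw : ∀ C, (∃ (m : ℕ) (γ : Fin (m + 1) → H), X.IsCycle γ ∧
          (∀ i, X.edge (γ i) ∈ Set.range r ∧ q (X.root (γ i)) = C) ∧ w C = ‖1 - ∏ i, u (γ i)‖) ∨
        ((¬ ∃ (m : ℕ) (γ : Fin (m + 1) → H), X.IsCycle γ ∧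
          ∀ i, X.edge (γ i) ∈ Set.range r ∧ q (X.root (γ i)) = C) ∧ w C = 1))
    (hdet : ((X.twistedIncidence u).submatrix r c).det ≠ 0) :
    ‖((X.twistedIncidence u).submatrix r c).det‖ = ∏ C, w C := by
  classical
  induction n generalizing w with
  | zero =>
    rw [Finset.prod_eq_one fun C _ => ?_]
    · simp
    · rcases hw C with ⟨m, γ, -, hγ, -⟩ | ⟨-, h⟩
      · obtain ⟨⟨i, -⟩, -⟩ := hγ 0
        exact i.elim0
      · exact h
  | succ n ih =>
    have hrinj := Matrix.injective_rows_of_det_ne_zero hdet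
    have hcinj := Matrix.injective_cols_of_det_ne_zero hdet
    by_cases hcyc : ∃ (m : ℕ) (γ : Fin (m + 1) → H), X.IsCycle γ ∧
          ∀ i, X.edge (γ i) ∈ Set.range r
    · obtain ⟨C, m, γ, hγ, hγC, hwC⟩ : ∃ C, ∃ (m : ℕ) (γ : Fin (m + 1) → H), X.IsCycle γ ∧
          (∀ i, X.edge (γ i) ∈ Set.range r ∧ q (X.root (γ i)) = C) ∧
          w C = ‖1 - ∏ i, u (γ i)‖ := by
        obtain ⟨m, γ, hγ, hS⟩ := hcyc
        refine ⟨q (X.root (γ 0)), (hw _).resolve_right fun h => h.1 ⟨m, γ, hγ, fun i => ⟨hS i, ?_⟩⟩⟩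
        -- consecutive vertices of the cycle lie in the same component
        have key : ∀ k : ℕ, q (X.root (γ (Fin.ofNat (m + 1) k))) = q (X.root (γ 0)) := by
          intro k
          induction k with
          | zero => rfl
          | succ k ih =>
            rw [← hγ.root_bar_ofNat, ← ih, eq_comm, hq]
            exact reachable_root_bar (hS _)
        have := key i
        rwa [show Fin.ofNat (m + 1) i = i from Fin.ext (by simp)] at this
      obtain ⟨-, i, j, hi, hj, hnorm⟩ :=
        exists_norm_det_eq_of_isCycle hu hu1 r c hdet hγ fun i => (hγC i).1
      have hrange := Fin.range_comp_succAbove hrinj i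
      rw [hi] at hrange
      have hdet' : ((X.twistedIncidence u).submatrix (r ∘ i.succAbove)
          (c ∘ j.succAbove)).det ≠ 0 := by
        intro h0
        rw [h0, norm_zero, mul_zero, norm_eq_zero] at hnorm
        exact hdet hnorm
      have hq' : ∀ a b, q a = q b ↔
          (X.adjGraph (Set.range (r ∘ i.succAbove))).Reachable a b := by
        intro a b
        rw [hq, hrange, reachable_diff_iff (hγ.reachable_diff fun i => (hγC i).1)]
      -- the component `C` has lost its only cycle
      have hC : ¬ ∃ (m : ℕ) (γ : Fin (m + 1) → H), X.IsCycle γ ∧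
          ∀ k, X.edge (γ k) ∈ Set.range (r ∘ i.succAbove) ∧ q (X.root (γ k)) = C := by
        rintro ⟨m', γ', hγ', hS'⟩
        have hreach := (hq' _ _).1 ((hS' 0).2.trans (hγC 0).2.symm)
        have hmem : X.root (γ 0) ∈ Set.range (c ∘ j.succAbove) := by
          cases n with
          | zero => exact (hS' 0).1.elim fun i => i.elim0
          | succ n =>
            exact (exists_norm_det_eq_of_isCycle hu hu1 _ _ hdet' hγ' fun k => (hS' k).1).1 _ hreach
        rw [Fin.range_comp_succAbove hcinj, hj] at hmem
        exact hmem.2 rfl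
      have := ih (Function.update w C 1) _ _ hq' (fun D => ?_) hdet'
      · rw [hnorm, this, ← hwC, Finset.prod_update_of_mem (Finset.mem_univ C), one_mul,
          ← Finset.prod_sdiff (Finset.subset_univ {C}), Finset.prod_singleton, mul_comm]
      · by_cases hD : D = C
        · subst hD
          exact Or.inr ⟨hC, Function.update_self ..⟩
        · rw [Function.update_of_ne hD]
          refine (hw D).imp ?_ ?_
          · rintro ⟨m', γ', hγ', hS', hw'⟩
            refine ⟨m', γ', hγ', fun k => ⟨?_, (hS' k).2⟩, hw'⟩
            rw [hrange]
            refine ⟨(hS' k).1, fun hk => hD ?_⟩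
            rw [← (hS' k).2, ← (hγC 0).2]
            rcases X.edge_eq_edge_iff.1 hk with h1 | h1
            · rw [h1]
            · rw [h1, eq_comm, hq]
              exact reachable_root_bar (hγC 0).1
          · rintro ⟨hno, h1⟩
            refine ⟨?_, h1⟩
            rintro ⟨m', γ', hγ', hS'⟩
            refine hno ⟨m', γ', hγ', fun k => ⟨?_, (hS' k).2⟩⟩
            have := (hS' k).1
            rw [hrange] at this
            exact this.1
    · rw [norm_det_eq_one_of_acyclic hu hu1 r c (fun m γ hγ hS => hcyc ⟨m, γ, hγ, hS⟩) hdet,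
        Finset.prod_eq_one fun C _ => ?_]
      rcases hw C with ⟨m, γ, hγ, hγC, -⟩ | ⟨-, h⟩
      · exact absurd ⟨m, γ, hγ, fun i => (hγC i).1⟩ hcyc
      · exact h

end SerreGraph

/-! ### The Laplacian, the matrix tree theorem and the order of the Jacobian -/

namespace SerreGraph

open Finset

variable {V H : Type*} (X : SerreGraph V H)

/-- The involution as a permutation of the half-edges. -/
def barEquiv : Equiv.Perm H := ⟨X.bar, X.bar, X.bar_bar, X.bar_bar⟩

theorem sum_halfEdges [Fintype H] [Fintype X.Edge] {M : Type*} [AddCommMonoid M] (g : H → M) :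
    ∑ h, g h = ∑ e : X.Edge, (g (Quotient.out e) + g (X.bar (Quotient.out e))) := by
  classical
  rw [← Finset.sum_fiberwise (s := univ) (g := X.edge)]
  refine sum_congr rfl fun e _ => ?_
  rw [← Finset.sum_pair (X.bar_ne _).symm]
  refine sum_congr ?_ fun _ _ => rfl
  ext h
  simp only [mem_filter, mem_univ, true_and, mem_insert, mem_singleton]
  conv_lhs => rw [← X.edge_out e, edge_eq_edge_iff]

open scoped Classical in
theorem laplacian_apply [Fintype H] (v v' : V) : X.laplacian v v' =
    ∑ h, if X.root h = v then
      (if v = v' then (1 : ℤ) else 0) - (if X.root (X.bar h) = v' then 1 else 0) else 0 := by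
  have hcard : ∀ p : H → Prop, (Nat.card {h // p h} : ℤ) = ∑ h, if p h then 1 else 0 := by
    intro p
    rw [Nat.card_eq_fintype_card, Fintype.card_subtype, Finset.card_filter]
    push_cast
    rfl
  have hdef : X.laplacian v v' = (if v = v' then (Nat.card {h : H // X.root h = v} : ℤ) else 0)
      - (Nat.card {h : H // X.root h = v ∧ X.root (X.bar h) = v'} : ℤ) := rfl
  have h1 : (if v = v' then ∑ h, (if X.root h = v then (1 : ℤ) else 0) else 0)
      = ∑ h, if v = v' then (if X.root h = v then (1 : ℤ) else 0) else 0 := by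
    split_ifs <;> simp
  rw [hdef, hcard, hcard, h1, ← sum_sub_distrib]
  refine sum_congr rfl fun h _ => ?_
  by_cases a : X.root h = v <;> simp [a]

theorem sum_row_laplacian [Fintype V] [Fintype H] (v : V) : ∑ v', X.laplacian v v' = 0 := by
  classical
  simp_rw [laplacian_apply]
  rw [sum_comm]
  refine sum_eq_zero fun h _ => ?_
  by_cases hv : X.root h = v
  · simp [hv, sum_sub_distrib]
  · simp [hv]

theorem sum_col_laplacian [Fintype V] [Fintype H] (v' : V) : ∑ v, X.laplacian v v' = 0 := by
  classical
  simp_rw [laplacian_apply]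
  rw [sum_comm]
  simp only [sum_ite_eq, mem_univ, if_true, sum_sub_distrib]
  rw [sub_eq_zero]
  exact (Equiv.sum_comp X.barEquiv fun h => if X.root h = v' then (1 : ℤ) else 0).symm

open scoped Classical in
/-- The twisted Laplacian `AᴴA`, where `A` is the matrix of the twisted coboundary. -/
theorem conjTranspose_twistedIncidence_mul_self [Fintype H] [Fintype X.Edge] {u : H → ℂ}
    (hu : ∀ h, u (X.bar h) * u h = 1) (hu1 : ∀ h, ‖u h‖ = 1) (v v' : V) :
    ((X.twistedIncidence u).conjTranspose * X.twistedIncidence u) v v' =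
      ∑ h, if X.root h = v then
        (if v = v' then (1 : ℂ) else 0) - u h * (if X.root (X.bar h) = v' then 1 else 0) else 0 := by
  have hstar : ∀ h, star (u h) = u (X.bar h) := by
    intro h
    have h0 : u h ≠ 0 := norm_ne_zero_iff.1 (by rw [hu1]; exact one_ne_zero)
    refine mul_right_cancel₀ h0 ?_
    rw [hu, RCLike.star_def, Complex.conj_mul', hu1]
    simp
  rw [Matrix.mul_apply, X.sum_halfEdges]
  refine sum_congr rfl fun e _ => ?_
  simp only [Matrix.conjTranspose_apply, twistedIncidence, Matrix.of_apply, star_sub, star_mul',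
    X.bar_bar]
  generalize (Quotient.out e : H) = h
  rw [hstar h]
  have h1 := hu h
  by_cases a : X.root h = v
  · by_cases b : X.root (X.bar h) = v
    · simp only [a, b, if_true, star_one]
      linear_combination (if v = v' then 1 else 0) * h1
    · simp only [a, b, if_true, if_false, star_one, star_zero]
      ring
  · by_cases b : X.root (X.bar h) = v
    · simp only [a, b, if_true, if_false, star_one, star_zero]
      linear_combination (if v = v' then 1 else 0) * h1
    · simp only [a, b, if_false, star_zero]
      ring

theorem conjTranspose_incidence_mul_self [Fintype H] [Fintype X.Edge] :
    (X.twistedIncidence fun _ => 1).conjTranspose * (X.twistedIncidence fun _ => 1)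
      = X.laplacian.map ((↑) : ℤ → ℂ) := by
  classical
  ext v v'
  rw [X.conjTranspose_twistedIncidence_mul_self (by simp) (by simp), Matrix.map_apply,
    laplacian_apply]
  push_cast
  simp

variable {X}

theorem eq_of_reachable {S : Set X.Edge} {α : Type*} {f : V → α}
    (hf : ∀ h, X.edge h ∈ S → f (X.root h) = f (X.root (X.bar h))) {a b : V}
    (hab : (X.adjGraph S).Reachable a b) : f a = f b :=
  reachable_induction (P := fun v => f a = f v) (fun h hS h0 => h0.trans (hf h hS)) hab rfl

/-- A spanning tree has one edge less than vertices: the coboundary is surjective onto the functions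
on the tree, since each edge is a bridge, and its kernel consists of the constants. -/
theorem IsSpanningTree.ncard_add_one [Fintype V] [Finite X.Edge] {T : Set X.Edge}
    (hT : X.IsSpanningTree T) : T.ncard + 1 = Fintype.card V := by
  classical
  have := Fintype.ofFinite X.Edge
  obtain ⟨v₀⟩ := hT.1.nonempty
  let A := (X.twistedIncidence fun _ => 1).submatrix ((↑) : T → X.Edge) id
  have hA : ∀ (f : V → ℂ) (h : H) (hh : X.edge h ∈ T), A.mulVec f ⟨X.edge h, hh⟩ = 0 ↔
      f (X.root h) = f (X.root (X.bar h)) := by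
    intro f h hh
    have := twistedIncidence_mulVec_eq_zero_iff (X := X) (u := fun _ => 1) (by simp) f h
    rwa [one_mul] at this
  have hker : LinearMap.ker A.mulVecLin = Submodule.span ℂ {fun _ => (1 : ℂ)} := by
    ext f
    rw [Submodule.mem_span_singleton, LinearMap.mem_ker, Matrix.mulVecLin_apply]
    constructor
    · intro hf
      refine ⟨f v₀, ?_⟩
      ext v
      have : f v₀ = f v := eq_of_reachable (S := T)
        (fun h hh => (hA f h hh).1 (congrFun hf _)) (hT.1.preconnected v₀ v)
      simp [this]
    · rintro ⟨a, rfl⟩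
      ext ⟨e, he⟩
      rw [← X.edge_out e] at he
      have := (hA (a • fun _ => 1) _ he).2 rfl
      simp only [X.edge_out] at this
      exact this
  have hrange : LinearMap.range A.mulVecLin = ⊤ := by
    rw [eq_top_iff, ← (Pi.basisFun ℂ T).span_eq, Submodule.span_le]
    rintro _ ⟨⟨e, he⟩, rfl⟩
    set h : H := Quotient.out e with hdef
    have hh : X.edge h = e := X.edge_out e
    have hbr := not_reachable_of_acyclic hT.2 (h := h) (hh ▸ he)
    refine ⟨fun v => if (X.adjGraph (T \ {X.edge h})).Reachable (X.root h) v then 1 else 0, ?_⟩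
    ext ⟨e', he'⟩
    rw [Matrix.mulVecLin_apply, Pi.basisFun_apply]
    by_cases hee : e' = e
    · subst hee
      rw [Pi.single_eq_same]
      change (X.twistedIncidence fun _ => 1).mulVec _ e' = 1
      rw [twistedIncidence_mulVec, ← hdef, if_pos SimpleGraph.Reachable.rfl, if_neg hbr]
      simp
    · rw [Pi.single_eq_of_ne (by simpa using hee)]
      have hk : X.edge (Quotient.out e') ∈ T \ {X.edge h} := by
        rw [hh, X.edge_out e']
        exact ⟨he', hee⟩
      have hk' := reachable_root_bar hk
      have := (hA (fun v => if (X.adjGraph (T \ {X.edge h})).Reachable (X.root h) v then 1 else 0)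
        (Quotient.out e') hk.1).2 (by
          refine if_congr ⟨fun h1 => h1.trans hk', fun h1 => h1.trans hk'.symm⟩ rfl rfl)
      simpa only [X.edge_out] using this
  have hrn := LinearMap.finrank_range_add_finrank_ker A.mulVecLin
  rw [hker, hrange, finrank_top, finrank_span_singleton (by
    intro h
    exact one_ne_zero (congrFun h v₀)), Module.finrank_fintype_fun_eq_card,
    Module.finrank_fintype_fun_eq_card] at hrn
  rw [← hrn, ← Nat.card_coe_set_eq, Nat.card_eq_fintype_card]

/-- The minors of the incidence matrix with one vertex removed detect the spanning trees. -/
theorem sq_norm_det_incidence_eq [Fintype V] {n : ℕ} {v₀ : V} {r : Fin n → X.Edge}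
    (c : Fin n → V) (hc : Function.Injective c) (hcr : Set.range c = {v | v ≠ v₀})
    [Decidable (X.IsSpanningTree (Set.range r))] :
    ‖((X.twistedIncidence fun _ => 1).submatrix r c).det‖ ^ 2 =
      if X.IsSpanningTree (Set.range r) then 1 else 0 := by
  classical
  have hflat : ∀ F : V → ℂ, (X.twistedIncidence fun _ => 1).mulVec F ∘ r = 0 ↔
      ∀ h, X.edge h ∈ Set.range r → F (X.root h) = F (X.root (X.bar h)) := by
    intro F
    constructor
    · rintro hF h ⟨i, hi⟩
      have := (twistedIncidence_mulVec_eq_zero_iff (X := X) (u := fun _ => 1) (by simp) F h).1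
        (by rw [← hi]; exact congrFun hF i)
      rwa [one_mul] at this
    · intro hF
      ext i
      rw [Function.comp_apply, ← X.edge_out (r i)]
      refine (twistedIncidence_mulVec_eq_zero_iff (by simp) F _).2 ?_
      rw [one_mul]
      exact hF _ ⟨i, (X.edge_out _).symm⟩
  have hacyc : ((X.twistedIncidence fun _ => 1).submatrix r c).det ≠ 0 →
      ∀ (m : ℕ) (γ : Fin (m + 1) → H), X.IsCycle γ → ¬ ∀ i, X.edge (γ i) ∈ Set.range r := by
    intro hdet m γ hγ hS
    cases n with
    | zero => exact (hS 0).elim fun i => i.elim0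
    | succ n =>
      obtain ⟨-, i, j, -, -, h⟩ :=
        exists_norm_det_eq_of_isCycle (by simp) (by simp) r c hdet hγ hS
      simp only [prod_const_one, sub_self, norm_zero, zero_mul, norm_eq_zero] at h
      exact hdet h
  split_ifs with hT
  · have hdet : ((X.twistedIncidence fun _ => 1).submatrix r c).det ≠ 0 := by
      intro h0
      obtain ⟨f, hf, hf0⟩ := Matrix.exists_mulVec_eq_zero_iff.2 h0
      have hsupp : ∀ v, v ∉ Set.range c → Function.extend c f 0 v = 0 := fun v hv => by
        exact Function.extend_apply' _ _ _ hv
      have h1 := Matrix.mulVec_submatrix_comp (X.twistedIncidence fun _ => 1) r hc hsupp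
      rw [Function.extend_comp hc, hf0] at h1
      have hv₀ : Function.extend c f 0 v₀ = 0 := hsupp _ (by rw [hcr]; simp)
      refine hf ?_
      ext i
      rw [← hc.extend_apply f 0 i, ← eq_of_reachable ((hflat _).1 h1.symm)
        (hT.1.preconnected v₀ (c i)), hv₀]
      rfl
    rw [norm_det_eq_one_of_acyclic (by simp) (by simp) r c hT.2 hdet, one_pow]
  · rw [sq_eq_zero_iff, norm_eq_zero]
    by_contra hdet
    have : Nonempty V := ⟨v₀⟩
    refine hT ⟨⟨fun a b => ?_⟩, hacyc hdet⟩
    suffices h : ∀ a, (X.adjGraph (Set.range r)).Reachable v₀ a from (h a).symm.trans (h b)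
    intro a
    by_contra ha
    -- the indicator function of the vertices not connected to `v₀` is flat
    let F : V → ℂ := fun v => if (X.adjGraph (Set.range r)).Reachable v₀ v then 0 else 1
    have hF : (X.twistedIncidence fun _ => 1).mulVec F ∘ r = 0 := by
      rw [hflat]
      intro h hh
      have hk' := reachable_root_bar hh
      exact if_congr ⟨fun h1 => h1.trans hk', fun h1 => h1.trans hk'.symm⟩ rfl rfl
    have h1 := Matrix.mulVec_submatrix_comp (X.twistedIncidence fun _ => 1) r hc (F := F) (by
      intro v hv
      rw [hcr] at hv
      have : v = v₀ := by simpa using hv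
      subst this
      exact if_pos SimpleGraph.Reachable.rfl)
    rw [hF] at h1
    have h2 := Matrix.eq_zero_of_mulVec_eq_zero hdet h1
    have ha' : a ∈ Set.range c := by
      rw [hcr]
      rintro rfl
      exact ha SimpleGraph.Reachable.rfl
    obtain ⟨i, rfl⟩ := ha'
    have := congrFun h2 i
    simp [F, ha] at this

/-- **Kirchhoff's matrix tree theorem**. -/
theorem det_laplacian_submatrix [Fintype V] [DecidableEq V] [Fintype H] (v₀ : V) :
    (X.laplacian.submatrix (Subtype.val : {v // v ≠ v₀} → V) Subtype.val).det
      = (X.numSpanningTrees : ℤ) := by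
  classical
  have := Fintype.ofFinite X.Edge
  set A := (X.twistedIncidence fun _ => 1).submatrix id (Subtype.val : {v // v ≠ v₀} → V)
  have hAA : A.conjTranspose * A =
      (X.laplacian.submatrix (Subtype.val : {v // v ≠ v₀} → V) Subtype.val).map
        (Int.castRingHom ℂ) := by
    have : A.conjTranspose * A = ((X.twistedIncidence fun _ => 1).conjTranspose *
        (X.twistedIncidence fun _ => 1)).submatrix Subtype.val Subtype.val := rfl
    rw [this, conjTranspose_incidence_mul_self]
    rfl
  have hdet := Matrix.det_conjTranspose_mul_self_eq_sum A
    (fun S => if X.IsSpanningTree (S : Set X.Edge) then 1 else 0) (by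
      intro S r hr hS c
      have hS' : (X.IsSpanningTree (S : Set X.Edge)) = X.IsSpanningTree (Set.range r) := by rw [hS]
      simp only [hS']
      exact sq_norm_det_incidence_eq (Subtype.val ∘ c)
        (Subtype.val_injective.comp c.injective) (by
          rw [Set.range_comp, c.range_eq_univ, Set.image_univ]
          exact Subtype.range_coe))
  rw [hAA, ← RingHom.mapMatrix_apply, ← RingHom.map_det] at hdet
  have hcount : (∑ S ∈ powersetCard (Fintype.card {v // v ≠ v₀}) (univ : Finset X.Edge),
      if X.IsSpanningTree (S : Set X.Edge) then (1 : ℝ) else 0) = X.numSpanningTrees := by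
    rw [numSpanningTrees, ← Nat.card_congr (Equiv.subtypeEquiv
      (p := fun S : Finset X.Edge => X.IsSpanningTree (S : Set X.Edge))
      (Fintype.finsetEquivSet (α := X.Edge)) fun S => by rw [Fintype.finsetEquivSet_apply]),
      Nat.card_eq_fintype_card,
      Fintype.card_subtype fun S : Finset X.Edge => X.IsSpanningTree (S : Set X.Edge),
      Finset.card_filter]
    simp only [Nat.cast_sum, Nat.cast_ite, Nat.cast_one, Nat.cast_zero]
    refine sum_subset (subset_univ _) fun S _ hS => if_neg fun hT => hS ?_
    rw [mem_powersetCard]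
    refine ⟨subset_univ _, ?_⟩
    have h1 := hT.ncard_add_one
    rw [Set.ncard_coe_finset] at h1
    have h2 := Fintype.card_congr (Equiv.optionSubtypeNe v₀)
    rw [Fintype.card_option] at h2
    omega
  rw [hcount] at hdet
  have h2 : (Int.castRingHom ℂ) ((X.laplacian.submatrix
      (Subtype.val : {v // v ≠ v₀} → V) Subtype.val).det) = (X.numSpanningTrees : ℤ) := by
    rw [hdet]
    push_cast
    rfl
  exact Int.cast_injective h2

theorem card_jac [Fintype V] [DecidableEq V] [Fintype H] (v₀ : V) :
    Nat.card X.Jac =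
      (X.laplacian.submatrix (Subtype.val : {v // v ≠ v₀} → V) Subtype.val).det.natAbs := by
  rw [← card_quotient_range_mulVecLin]
  -- a divisor of degree zero is determined by its values outside `v₀`
  let ψ : divZero V →ₗ[ℤ] ({v // v ≠ v₀} → ℤ) :=
    (LinearMap.funLeft ℤ ℤ (Subtype.val : {v // v ≠ v₀} → V)).comp (divZero V).subtype
  have hsplit : ∀ a : V → ℤ, ∑ v, a v = a v₀ + ∑ v : {v // v ≠ v₀}, a v := by
    intro a
    rw [Fintype.sum_eq_add_sum_subtype_ne]
  have hψ : Function.Bijective ψ := by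
    constructor
    · rw [← LinearMap.ker_eq_bot, LinearMap.ker_eq_bot']
      rintro ⟨a, ha⟩ h
      have h1 : ∀ v : {v // v ≠ v₀}, a v = 0 := fun v => congrFun h v
      have ha' : ∑ v, a v = 0 := ha
      rw [hsplit, sum_eq_zero (fun v _ => h1 v), add_zero] at ha'
      ext v
      by_cases hv : v = v₀
      · subst hv
        exact ha'
      · exact h1 ⟨v, hv⟩
    · intro g
      let a : V → ℤ := fun v => if hv : v ≠ v₀ then g ⟨v, hv⟩ else -∑ w, g w
      have h1 : ∀ v : {v // v ≠ v₀}, a v = g v := fun v => dif_pos v.2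
      refine ⟨⟨a, ?_⟩, funext h1⟩
      change ∑ v, a v = 0
      rw [hsplit, sum_congr rfl fun v _ => h1 v]
      simp [a]
  refine Nat.card_congr (Submodule.Quotient.equiv _ _ (LinearEquiv.ofBijective ψ hψ) ?_).toEquiv
  have hL : ∀ f : V → ℤ, f v₀ = 0 → ∀ v : {v // v ≠ v₀}, X.laplacian.mulVec f v =
      (X.laplacian.submatrix (Subtype.val : {v // v ≠ v₀} → V) Subtype.val).mulVec
        (fun w : {v // v ≠ v₀} => f w) v := by
    intro f hf v
    simp only [Matrix.mulVec, dotProduct, Matrix.submatrix_apply]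
    rw [hsplit, hf, mul_zero, zero_add]
  ext g
  constructor
  · rintro ⟨⟨a, ha⟩, ⟨f, hf⟩, rfl⟩
    refine ⟨fun w => f w - f v₀, ?_⟩
    ext v
    have h1 : X.laplacian.mulVec (fun w => f w - f v₀) = X.laplacian.mulVec f := by
      ext v
      simp only [Matrix.mulVec, dotProduct, mul_sub, sum_sub_distrib, ← sum_mul,
        sum_row_laplacian, zero_mul, sub_zero]
    have hf' : X.laplacian.mulVec f = a := hf
    rw [Matrix.mulVecLin_apply, ← hL (fun w => f w - f v₀) (sub_self _), h1, hf']
    rfl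
  · rintro ⟨g, rfl⟩
    let f : V → ℤ := fun v => if hv : v ≠ v₀ then g ⟨v, hv⟩ else 0
    have hdeg : X.laplacian.mulVec f ∈ divZero V := by
      change ∑ v, X.laplacian.mulVec f v = 0
      simp only [Matrix.mulVec, dotProduct]
      rw [sum_comm]
      simp [← sum_mul, sum_col_laplacian]
    refine ⟨⟨X.laplacian.mulVec f, hdeg⟩, ⟨f, rfl⟩, ?_⟩
    ext v
    change X.laplacian.mulVec f v = _
    rw [hL f (by simp [f])]
    congr 1
    ext w
    simp [f, w.2]

theorem card_jac_eq_numSpanningTrees [Fintype V] [Nonempty V] [Fintype H] :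
    Nat.card X.Jac = X.numSpanningTrees := by
  classical
  rw [card_jac (Classical.arbitrary V), det_laplacian_submatrix, Int.natAbs_natCast]

end SerreGraph

/-! ### The twisted matroid of a cover -/

namespace SerreGraph.HarmonicCover

open Finset

variable {V H W K G : Type*} [CommGroup G] [Fintype G] [Fintype W] [MulAction G W] [MulAction G K]
  {Y : SerreGraph W K} {X : SerreGraph V H} {p : HarmonicCover G Y X}

/-- The character `ρ` is trivial on the dilation group of `v`. These vertices index the `ρ`-isotypic
part of the functions on the vertices of the cover. -/
def Undilated (p : HarmonicCover G Y X) (ρ : G →* ℂˣ) (v : V) : Prop :=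
  ∀ g ∈ p.dilation v, ρ g = 1

/-- The dilation group is the stabilizer of each point of the fiber, as `G` is commutative. -/
theorem smul_eq_iff_mem_dilation (p : HarmonicCover G Y X) (g : G) (w : W) :
    g • w = w ↔ g ∈ p.dilation (p.onV w) := by
  refine ⟨fun h w' hw' => ?_, fun h => h w rfl⟩
  obtain ⟨a, rfl⟩ := p.transitive_V w w' hw'.symm
  rw [smul_smul, mul_comm, ← smul_smul, h]

namespace Voltage

theorem smul_base_eq_iff (e : p.Voltage) {a b : G} {v v' : V} :
    a • e.base v = b • e.base v' ↔ v = v' ∧ b⁻¹ * a ∈ p.dilation v' := by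
  have h1 : ∀ a v, p.onV (a • e.base v) = v := fun a v => by rw [p.onV_smul, e.onV_base]
  constructor
  · intro h
    have hv : v = v' := by rw [← h1 a v, h, h1]
    subst hv
    refine ⟨rfl, ?_⟩
    have := (p.smul_eq_iff_mem_dilation (b⁻¹ * a) (e.base v)).1
      (by rw [mul_smul, h, inv_smul_smul])
    rwa [e.onV_base] at this
  · rintro ⟨rfl, h⟩
    rw [← inv_smul_eq_iff, smul_smul]
    exact h _ (e.onV_base v)

theorem exists_smul_base (e : p.Voltage) (w : W) : ∃ g : G, g • e.base (p.onV w) = w :=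
  p.transitive_V _ _ (e.onV_base _)

/-- A group element that moves the base point of the fiber to `w`; it is determined up to the
dilation group. -/
noncomputable def label (e : p.Voltage) (w : W) : G := (e.exists_smul_base w).choose

theorem label_smul_base (e : p.Voltage) (w : W) : e.label w • e.base (p.onV w) = w :=
  (e.exists_smul_base w).choose_spec

theorem map_label_smul_base (e : p.Voltage) {ρ : G →* ℂˣ} {v : V} (hv : p.Undilated ρ v) (a : G) :
    ρ (e.label (a • e.base v)) = ρ a := by
  have h := e.label_smul_base (a • e.base v)
  rw [smul_base_eq_iff] at h
  have := hv _ h.2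
  rwa [map_mul, map_inv, inv_mul_eq_one, eq_comm] at this

/-- The voltages evaluated by a character. -/
noncomputable def charVoltage (e : p.Voltage) (ρ : G →* ℂˣ) (h : H) : ℂ := ρ (e.η h)

theorem charVoltage_bar_mul (e : p.Voltage) (ρ : G →* ℂˣ) (h : H) :
    e.charVoltage ρ (X.bar h) * e.charVoltage ρ h = 1 := by
  rw [charVoltage, charVoltage, e.η_bar, ← Units.val_mul, ← map_mul, inv_mul_cancel, map_one,
    Units.val_one]

theorem norm_charVoltage (e : p.Voltage) (ρ : G →* ℂˣ) (h : H) : ‖e.charVoltage ρ h‖ = 1 := by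
  refine Complex.norm_eq_one_of_pow_eq_one (n := Fintype.card G) ?_ Fintype.card_ne_zero
  rw [charVoltage, ← Units.val_pow_eq_pow_val, ← map_pow, pow_card_eq_one, map_one, Units.val_one]

/-- The matrix of the `ρ`-twisted coboundary on the functions supported on the vertices whose
dilation group is killed by `ρ`. -/
noncomputable def coboundary (e : p.Voltage) (ρ : G →* ℂˣ) :
    Matrix X.Edge {v // p.Undilated ρ v} ℂ :=
  (X.twistedIncidence (e.charVoltage ρ)).submatrix id Subtype.val

/-- Extension by zero of a function on the vertices whose dilation group is killed by `ρ`. -/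
theorem exists_extend (p : HarmonicCover G Y X) (ρ : G →* ℂˣ)
    (f : {v // p.Undilated ρ v} → ℂ) :
    ∃ F : V → ℂ, (∀ v, ¬ p.Undilated ρ v → F v = 0) ∧ f = fun v => F v.1 := by
  classical
  exact ⟨fun v => if hv : p.Undilated ρ v then f ⟨v, hv⟩ else 0, fun v hv => dif_neg hv, by
    ext v
    simp [v.2]⟩

section

variable [Fintype V]

open scoped Classical in
theorem coboundary_mulVec_eq_zero_iff (e : p.Voltage) {ρ : G →* ℂˣ}
    (F : V → ℂ) (hF : ∀ v, ¬ p.Undilated ρ v → F v = 0) (h : H) :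
    (e.coboundary ρ).mulVec (fun v => F v) (X.edge h) = 0 ↔
      F (X.root h) = ρ (e.η h) * F (X.root (X.bar h)) := by
  have := Matrix.mulVec_submatrix_comp (X.twistedIncidence (e.charVoltage ρ)) id
    (Subtype.val_injective (p := p.Undilated ρ)) (F := F)
    (fun v hv => hF v fun h => hv ⟨⟨v, h⟩, rfl⟩)
  have h2 : (e.coboundary ρ).mulVec (fun v => F v) (X.edge h)
      = (X.twistedIncidence (e.charVoltage ρ)).mulVec F (X.edge h) := congrFun this _
  rw [h2]
  exact twistedIncidence_mulVec_eq_zero_iff (e.charVoltage_bar_mul ρ) F h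

open scoped Classical in
/-- The twisted coboundary is injective: a flat function on the vertices of `X` would give a
constant function on the connected graph `Y` on which `G` acts through `ρ`. -/
theorem eq_zero_of_coboundary_eq_zero (e : p.Voltage) (hY : Y.Connected) {ρ : G →* ℂˣ} (hρ : ρ ≠ 1)
    (f : {v // p.Undilated ρ v} → ℂ) (hf : (e.coboundary ρ).mulVec f = 0) : f = 0 := by
  obtain ⟨F, hF, rfl⟩ := exists_extend p ρ f
  have hflat : ∀ h, F (X.root h) = ρ (e.η h) * F (X.root (X.bar h)) := fun h =>
    (e.coboundary_mulVec_eq_zero_iff F hF h).1 (congrFun hf _)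
  let Ψ : W → ℂ := fun w => ρ (e.label w) * F (p.onV w)
  have hΨ : ∀ a v, Ψ (a • e.base v) = ρ a * F v := by
    intro a v
    simp only [Ψ, p.onV_smul, e.onV_base]
    by_cases hv : p.Undilated ρ v
    · rw [e.map_label_smul_base hv]
    · rw [hF v hv, mul_zero, mul_zero]
  have hconst : ∀ w w', Ψ w = Ψ w' := fun w w' => by
    refine eq_of_reachable (S := Set.univ) (fun k _ => ?_) (hY.preconnected w w')
    obtain ⟨k₀, hk₀, hs, ht⟩ := e.exists_lift (p.onH k)
    obtain ⟨g, rfl⟩ := p.transitive_H k₀ k hk₀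
    rw [p.onH_smul] at hs ht
    rw [p.root_smul, p.bar_smul, p.root_smul, hs, ht, smul_smul, hΨ, hΨ, map_mul, Units.val_mul,
      mul_assoc, ← hflat]
  obtain ⟨a, ha⟩ : ∃ a, ρ a ≠ 1 := by
    by_contra! h
    exact hρ (MonoidHom.ext h)
  ext v
  have h1 := hconst (a • e.base v) ((1 : G) • e.base v)
  rw [hΨ, hΨ, map_one, Units.val_one] at h1
  have h2 : ((ρ a : ℂ) - 1) * F v = 0 := by linear_combination h1
  exact (mul_eq_zero.1 h2).resolve_left fun h3 => ha (Units.ext (sub_eq_zero.1 h3))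

open scoped Classical in
/-- A component of `X ∖ F` carries a nonzero flat function exactly when the twisted cover is trivial
on it. -/
theorem forall_not_twistTrivialOn_iff (e : p.Voltage) (ρ : G →* ℂˣ) (F : Set X.Edge) :
    (∀ C : X.Component F, ¬ e.TwistTrivialOn ρ F C) ↔
      ∀ f, (∀ a, a ∉ F → (e.coboundary ρ).mulVec f a = 0) → f = 0 := by
  constructor
  · intro hC f hf
    obtain ⟨f, hf0, rfl⟩ := exists_extend p ρ f
    have hflat : ∀ h, X.edge h ∈ Fᶜ → f (X.root h) = ρ (e.η h) * f (X.root (X.bar h)) :=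
      fun h hh => (e.coboundary_mulVec_eq_zero_iff f hf0 h).1 (hf _ hh)
    by_contra hne
    obtain ⟨⟨v₀, hu₀⟩, hv₀⟩ := Function.ne_iff.1 hne
    have hv₀ : f v₀ ≠ 0 := hv₀
    have hreach : ∀ v, X.componentOf F v = X.componentOf F v₀ →
        (X.adjGraph Fᶜ).Reachable v₀ v := fun v hv =>
      (SimpleGraph.ConnectedComponent.eq.1 hv).symm
    have hne : ∀ v, X.componentOf F v = X.componentOf F v₀ → f v ≠ 0 := fun v hv =>
      ne_zero_of_reachable hflat (hreach v hv) hv₀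
    -- the values of a flat function on a component differ by values of `ρ`
    have hrat : ∀ v, X.componentOf F v = X.componentOf F v₀ → ∃ g : G, f v₀ = ρ g * f v := by
      intro v hv
      refine reachable_induction (P := fun v => ∃ g : G, f v₀ = ρ g * f v) (fun h hh => ?_)
        (hreach v hv) ⟨1, by simp⟩
      rintro ⟨g, hg⟩
      exact ⟨g * e.η h, by rw [hg, hflat h hh, map_mul, Units.val_mul, mul_assoc]⟩
    choose! ξ hξ using hrat
    refine hC (X.componentOf F v₀) ⟨fun v hv => ?_, ξ, fun h hh hc => ?_⟩
    · by_contra hu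
      exact hne v hv (hf0 v hu)
    · have hc' : X.componentOf F (X.root (X.bar h)) = X.componentOf F v₀ := by
        rw [← hc]
        exact SimpleGraph.ConnectedComponent.eq.2 (reachable_root_bar hh).symm
      have h1 := hξ _ hc
      have h2 := hξ _ hc'
      rw [hflat h hh, h2, ← mul_assoc] at h1
      have h3 := mul_right_cancel₀ (hne _ hc') h1
      rw [eq_div_iff_mul_eq', eq_comm]
      exact Units.ext (by rw [h3, Units.val_mul, mul_comm])
  · rintro hf C ⟨hC, ξ, hξ⟩
    let f : V → ℂ := fun v => if X.componentOf F v = C then (((ρ (ξ v))⁻¹ : ℂˣ) : ℂ) else 0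
    have hf0 : ∀ v, ¬ p.Undilated ρ v → f v = 0 := fun v hv => if_neg fun h => hv (hC v h)
    have h0 := hf (fun v => f v) fun a ha => by
      rw [← X.edge_out a] at ha ⊢
      rw [e.coboundary_mulVec_eq_zero_iff f hf0]
      have hc : X.componentOf F (X.root (Quotient.out a : H)) =
          X.componentOf F (X.root (X.bar (Quotient.out a : H))) :=
        SimpleGraph.ConnectedComponent.eq.2 (reachable_root_bar ha)
      simp only [f, ← hc]
      split_ifs with h
      · rw [← Units.val_mul, hξ _ ha h]
        congr 1
        rw [div_mul_eq_mul_div, mul_inv_cancel, one_div]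
      · simp
    obtain ⟨v, rfl⟩ := C.exists_rep
    have := congrFun h0 ⟨v, hC v rfl⟩
    simp only [f] at this
    exact (Units.ne_zero _) ((if_pos rfl).symm.trans this)

open scoped Classical in
/-- The twisted matroid is the matroid of the cokernel of the twisted coboundary. -/
theorem isTwistedMatroid_cokernelMatroid [Fintype X.Edge] (e : p.Voltage) (hY : Y.Connected)
    {ρ : G →* ℂˣ} (hρ : ρ ≠ 1) : e.IsTwistedMatroid ρ (cokernelMatroid (e.coboundary ρ)) := by
  refine ⟨rfl, fun F => ?_⟩
  rw [cokernelMatroid_indep, forall_not_twistTrivialOn_iff]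
  refine forall_congr' fun f => imp_congr_right fun _ =>
    ⟨e.eq_zero_of_coboundary_eq_zero hY hρ f, ?_⟩
  rintro rfl
  exact Matrix.mulVec_zero _

/-- The weight of the complement of the edge set of a nonzero maximal minor of the twisted
coboundary. -/
theorem sq_norm_det_coboundary (e : p.Voltage) (ρ : G →* ℂˣ) (F : Set X.Edge) {n : ℕ}
    (r : Fin n → X.Edge) (c : Fin n → V) (hr : Fᶜ = Set.range r)
    (hdet : ((X.twistedIncidence (e.charVoltage ρ)).submatrix r c).det ≠ 0) :
    ‖((X.twistedIncidence (e.charVoltage ρ)).submatrix r c).det‖ ^ 2 = e.weight ρ F := by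
  classical
  let w : X.Component F → ℝ := fun C =>
    if h : ∃ γ : (n : ℕ) × (Fin (n + 1) → H), IsCycleIn X F C γ.2 then
      ‖1 - (ρ (∏ i, e.η (h.choose.2 i)) : ℂ)‖ else 1
  have hprod : ∀ (m : ℕ) (γ : Fin (m + 1) → H),
      ((ρ (∏ i, e.η (γ i)) : ℂˣ) : ℂ) = ∏ i, e.charVoltage ρ (γ i) := by
    intro m γ
    rw [map_prod, Units.coe_prod]
    rfl
  have hF : ∀ a, a ∉ F ↔ a ∈ Set.range r := fun a => by rw [← hr]; rfl
  rw [norm_det_eq_prod_weight (e.charVoltage_bar_mul ρ) (e.norm_charVoltage ρ)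
    (X.componentOf F) w r c (fun a b => by rw [← hr]; exact SimpleGraph.ConnectedComponent.eq)
    (fun C => ?_) hdet, ← prod_pow, weight, finprod_eq_prod_of_fintype]
  · refine prod_congr rfl fun C _ => ?_
    simp only [w, componentWeight]
    split_ifs
    · rfl
    · exact one_pow 2
  · by_cases h : ∃ γ : (n : ℕ) × (Fin (n + 1) → H), IsCycleIn X F C γ.2
    · refine Or.inl ⟨h.choose.1, h.choose.2, h.choose_spec.1, fun i => ?_, ?_⟩
      · exact ⟨(hF _).1 (h.choose_spec.2 i).1, (h.choose_spec.2 i).2⟩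
      · simp only [w, dif_pos h, hprod]
    · refine Or.inr ⟨?_, dif_neg h⟩
      rintro ⟨m, γ, hγ, hγC⟩
      exact h ⟨⟨m, γ⟩, hγ, fun i => ⟨(hF _).2 (hγC i).1, (hγC i).2⟩⟩

open scoped Classical in
/-- The weight of the twisted matroid is the Gram determinant of the twisted coboundary. -/
theorem det_conjTranspose_coboundary_mul [Fintype X.Edge] (e : p.Voltage) (hY : Y.Connected)
    {ρ : G →* ℂˣ} (hρ : ρ ≠ 1) : ((e.coboundary ρ).conjTranspose * e.coboundary ρ).det =
      (e.matroidWeight ρ (cokernelMatroid (e.coboundary ρ)) : ℂ) := by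
  have hbase := cokernelMatroid_isBase (e.coboundary ρ) (e.eq_zero_of_coboundary_eq_zero hY hρ)
  let t : Finset X.Edge → ℝ := fun S =>
    if (cokernelMatroid (e.coboundary ρ)).IsBase (S : Set X.Edge)ᶜ then e.weight ρ (S : Set X.Edge)ᶜ
    else 0
  have hcard : ∀ S : Finset X.Edge, (S : Set X.Edge)ᶜ.ncard + #S = Fintype.card X.Edge := by
    intro S
    rw [← Set.ncard_coe_finset, add_comm, Set.ncard_add_ncard_compl, Nat.card_eq_fintype_card]
  rw [Matrix.det_conjTranspose_mul_self_eq_sum (e.coboundary ρ) t]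
  · congr 1
    simp only [matroidWeight, finsum_eq_if]
    rw [finsum_eq_sum_of_fintype,
      ← Equiv.sum_comp ((Fintype.finsetEquivSet (α := X.Edge)).trans compl_involutive.toPerm)]
    refine sum_subset (subset_univ _) fun S _ hS => if_neg fun hB => hS ?_
    have h1 := ((hbase _).1 hB).2
    rw [← hcard S] at h1
    exact mem_powersetCard.2 ⟨subset_univ _, by omega⟩
  · intro S r hr hS c
    have hmul : ∀ f : {v // p.Undilated ρ v} → ℂ,
        ((e.coboundary ρ).submatrix r c).mulVec (f ∘ c) = (e.coboundary ρ).mulVec f ∘ r := fun f =>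
      Matrix.mulVec_submatrix_comp (e.coboundary ρ) r c.injective
        fun v hv => absurd (c.surjective v) hv
    have hmem : ∀ a, a ∉ ((S : Set X.Edge)ᶜ : Set X.Edge) ↔ a ∈ Set.range r := fun a => by
      rw [Set.notMem_compl_iff, hS]
    have hiff : (cokernelMatroid (e.coboundary ρ)).IsBase (S : Set X.Edge)ᶜ ↔
        ((e.coboundary ρ).submatrix r c).det ≠ 0 := by
      rw [hbase]
      constructor
      · rintro ⟨hinj, -⟩ h0
        obtain ⟨f, hf, hf0⟩ := Matrix.exists_mulVec_eq_zero_iff.2 h0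
        refine hf ?_
        have h1 := hmul (f ∘ c.symm)
        rw [Function.comp_assoc, c.symm_comp_self, Function.comp_id, hf0] at h1
        have h2 := hinj (f ∘ c.symm) fun a ha => by
          obtain ⟨i, rfl⟩ := (hmem a).1 ha
          exact (congrFun h1 i).symm
        ext i
        simpa using congrFun h2 (c i)
      · intro hdet
        refine ⟨fun f hf => ?_, ?_⟩
        · have h1 := Matrix.eq_zero_of_mulVec_eq_zero hdet (v := f ∘ c) (by
            rw [hmul]
            ext i
            exact hf _ ((hmem _).2 ⟨i, rfl⟩))
          ext v
          simpa using congrFun h1 (c.symm v)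
        · rw [← hcard S]
          congr 1
          rw [← Set.ncard_coe_finset, hS, ← Set.image_univ, Set.ncard_image_of_injective _ hr,
            Set.ncard_univ, Nat.card_eq_fintype_card, Fintype.card_fin]
    simp only [t, hiff]
    split_ifs with h
    · exact e.sq_norm_det_coboundary ρ _ r (Subtype.val ∘ c) (by rw [compl_compl, hS]) h
    · rw [not_not.1 h]
      simp

end

end Voltage

end SerreGraph.HarmonicCover

/-! ### Decomposition of the Laplacian of the cover -/

/-- Two square matrices intertwined by an injective matrix have the same determinant. -/
theorem Matrix.det_eq_of_mul_eq_mul {m n : Type*} [Fintype m] [DecidableEq m] [Fintype n]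
    [DecidableEq n] (hmn : Fintype.card m = Fintype.card n) (T : Matrix m m ℂ) (B : Matrix n n ℂ)
    (P : Matrix m n ℂ) (hP : ∀ c, P.mulVec c = 0 → c = 0) (h : T * P = P * B) : T.det = B.det := by
  let ι : m ≃ n := Fintype.equivOfCardEq hmn
  have hdet : (P.submatrix id ι).det ≠ 0 := by
    intro h0
    obtain ⟨f, hf, hf0⟩ := Matrix.exists_mulVec_eq_zero_iff.2 h0
    refine hf ?_
    have h1 := hP (f ∘ ι.symm) (by
      rw [Matrix.submatrix_mulVec_equiv, Function.comp_id] at hf0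
      exact hf0)
    ext i
    simpa using congrFun h1 (ι i)
  have h2 : T * P.submatrix id ι = P.submatrix id ι * B.submatrix ι ι := by
    rw [Matrix.submatrix_mul_equiv, ← h]
    rfl
  have h3 := congrArg Matrix.det h2
  rw [Matrix.det_mul, Matrix.det_mul, Matrix.det_submatrix_equiv_self, mul_comm] at h3
  exact mul_left_cancel₀ hdet h3

namespace SerreGraph

open Finset Matrix

theorem det_laplacian_add_vecMulVec {V H : Type*} (X : SerreGraph V H) [Fintype V] [DecidableEq V]
    [Nonempty V] [Fintype H] (a b : V → ℂ) :
    (X.laplacian.map ((↑) : ℤ → ℂ) + vecMulVec a b).det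
      = (∑ v, a v) * (∑ v, b v) * X.numSpanningTrees := by
  have hrow : ∀ v, ∑ v', X.laplacian.map ((↑) : ℤ → ℂ) v v' = 0 := fun v => by
    simp only [map_apply]
    exact_mod_cast X.sum_row_laplacian v
  have hcol : ∀ v', ∑ v, X.laplacian.map ((↑) : ℤ → ℂ) v v' = 0 := fun v => by
    simp only [map_apply]
    exact_mod_cast X.sum_col_laplacian v
  let v₀ := Classical.arbitrary V
  rw [det_add_vecMulVec_of_sum_eq_zero _ hrow hcol a b v₀]
  congr 1
  have h := congrArg (Int.castRingHom ℂ) (det_laplacian_submatrix (X := X) v₀)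
  rw [RingHom.map_det] at h
  rw [eq_intCast, Int.cast_natCast] at h
  rw [← h]
  rfl

open scoped Classical in
theorem map_laplacian_mulVec {V H : Type*} (X : SerreGraph V H) [Fintype V] [Fintype H]
    (f : V → ℂ) (v : V) : (X.laplacian.map ((↑) : ℤ → ℂ)).mulVec f v =
      ∑ h, if X.root h = v then f v - f (X.root (X.bar h)) else 0 := by
  simp only [mulVec, dotProduct, map_apply, laplacian_apply]
  push_cast
  simp only [sum_mul]
  rw [sum_comm]
  refine sum_congr rfl fun h _ => ?_
  split_ifs
  · simp [sub_mul, sum_sub_distrib]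
  · simp

namespace HarmonicCover

variable {V H W K G : Type*} [CommGroup G] [Fintype G] [Fintype W] [MulAction G W] [MulAction G K]
  {Y : SerreGraph W K} {X : SerreGraph V H} {p : HarmonicCover G Y X}

theorem card_undilated_characters (p : HarmonicCover G Y X) (v : V) :
    Nat.card {ρ : G →* ℂˣ // p.Undilated ρ v} = Nat.card (G ⧸ p.dilation v) := by
  rw [← CommGroup.card_domRestrictHom_ker (M := ℂ)]
  refine Nat.card_congr (Equiv.subtypeEquivRight fun ρ => ?_)
  rw [MonoidHom.mem_ker, MonoidHom.ext_iff]
  exact ⟨fun h g => h g g.2, fun h g hg => h ⟨g, hg⟩⟩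

namespace Voltage

theorem card_fiber (e : p.Voltage) (v : V) :
    Nat.card {w // p.onV w = v} = Nat.card (G ⧸ p.dilation v) := by
  have hst : MulAction.stabilizer G (e.base v) = p.dilation v := by
    ext g
    rw [MulAction.mem_stabilizer_iff, p.smul_eq_iff_mem_dilation, e.onV_base]
  rw [← hst, ← Nat.card_congr (MulAction.orbitEquivQuotientStabilizer G (e.base v))]
  refine Nat.card_congr (Equiv.subtypeEquivRight fun w => ?_)
  constructor
  · rintro rfl
    exact ⟨e.label w, e.label_smul_base w⟩
  · rintro ⟨g, rfl⟩
    exact (p.onV_smul _ _).trans (e.onV_base v)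

theorem sum_card_quotient_dilation [Fintype V] (e : p.Voltage) :
    ∑ v, Nat.card (G ⧸ p.dilation v) = Fintype.card W := by
  simp_rw [← e.card_fiber]
  rw [← Nat.card_sigma, Nat.card_congr (Equiv.sigmaFiberEquiv p.onV), Nat.card_eq_fintype_card]

open scoped Classical in
/-- The function supported on the fiber over `v` on which `G` acts through `ρ`, normalized at the
base point. -/
noncomputable def wave (e : p.Voltage) (ρ : G →* ℂˣ) (v : V) (w : W) : ℂ :=
  if p.onV w = v then ρ (e.label w) else 0

open scoped Classical in
theorem wave_smul_base (e : p.Voltage) {ρ : G →* ℂˣ} {v : V} (hv : p.Undilated ρ v) (a : G)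
    (v' : V) : e.wave ρ v (a • e.base v') = if v' = v then (ρ a : ℂ) else 0 := by
  rw [wave, p.onV_smul, e.onV_base]
  split_ifs with h
  · subst h
    rw [e.map_label_smul_base hv]
  · rfl

/-- Summation over the half-edges of the cover through lifts starting at the base points. -/
theorem exists_lift_sum_eq [Fintype H] [Fintype K] (e : p.Voltage) : ∃ l : H → K,
    (∀ h, Y.root (l h) = e.base (X.root h)) ∧
    (∀ h, Y.root (Y.bar (l h)) = e.η h • e.base (X.root (X.bar h))) ∧
    ∀ F : K → ℂ, ∑ k, F k = ∑ h, ∑ g : G, F (g • l h) := by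
  choose l hl hs ht using e.exists_lift
  refine ⟨l, hs, ht, fun F => ?_⟩
  rw [← Fintype.sum_prod_type' fun h (g : G) => F (g • l h)]
  refine (Fintype.sum_bijective (fun x : H × G => x.2 • l x.1) ⟨?_, fun k => ?_⟩ _ _
    fun _ => rfl).symm
  · rintro ⟨h, g⟩ ⟨h', g'⟩ heq
    simp only at heq
    have h1 : h = h' := by
      have := congrArg p.onH heq
      rwa [p.onH_smul, p.onH_smul, hl, hl] at this
    subst h1
    have h2 := p.free_H (g'⁻¹ * g) (l h) (by rw [mul_smul, heq, inv_smul_smul])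
    rw [inv_mul_eq_one] at h2
    rw [h2]
  · obtain ⟨g, hg⟩ := p.transitive_H (l (p.onH k)) k (hl _)
    exact ⟨(p.onH k, g), hg⟩

open scoped Classical in
/-- The sum of a character over a coset of the dilation group. -/
theorem sum_coset_dilation (p : HarmonicCover G Y X) (ρ : G →* ℂˣ) (v : V) (a : G) :
    ∑ g, (if a⁻¹ * g ∈ p.dilation v then (ρ g : ℂ) else 0) =
      if p.Undilated ρ v then (Nat.card (p.dilation v) : ℂ) * ρ a else 0 := by
  rw [← Equiv.sum_comp (Equiv.mulLeft a)]
  simp only [Equiv.coe_mulLeft, inv_mul_cancel_left, map_mul, Units.val_mul]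
  rw [← sum_filter, ← mul_sum, sum_subtype (p := fun g => g ∈ p.dilation v) _ (by simp)]
  have h1 := sum_hom_units (((Units.coeHom ℂ).comp ρ).comp (p.dilation v).subtype)
  have h2 : ((Units.coeHom ℂ).comp ρ).comp (p.dilation v).subtype = 1 ↔ p.Undilated ρ v := by
    rw [MonoidHom.ext_iff]
    constructor
    · intro h g hg
      exact Units.ext (h ⟨g, hg⟩)
    · intro h g
      exact congrArg Units.val (h g g.2)
  simp only [h2, MonoidHom.comp_apply, Units.coeHom_apply, Subgroup.subtype_apply] at h1
  rw [h1, Nat.card_eq_fintype_card]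
  split_ifs
  · rw [mul_comm]
  · rw [Nat.cast_zero, mul_zero]

open scoped Classical in
theorem sum_wave (e : p.Voltage) {ρ : G →* ℂˣ} {v : V} (hv : p.Undilated ρ v) :
    ∑ w, e.wave ρ v w = if ρ = 1 then (Nat.card (G ⧸ p.dilation v) : ℂ) else 0 := by
  split_ifs with hρ
  · subst hρ
    simp only [wave, MonoidHom.one_apply, Units.val_one]
    rw [← e.card_fiber, Nat.card_eq_fintype_card, Fintype.card_subtype, card_filter]
    push_cast
    rfl
  · obtain ⟨a, ha⟩ : ∃ a, ρ a ≠ 1 := by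
      by_contra! h
      exact hρ (MonoidHom.ext h)
    have h1 : ∀ w, e.wave ρ v (a • w) = ρ a * e.wave ρ v w := by
      intro w
      rw [← e.label_smul_base w, smul_smul, e.wave_smul_base hv, e.wave_smul_base hv, map_mul,
        Units.val_mul, mul_ite, mul_zero]
    have h2 : ∑ w, e.wave ρ v w = ρ a * ∑ w, e.wave ρ v w := by
      rw [mul_sum, ← sum_congr rfl fun w _ => h1 w]
      exact (Equiv.sum_comp (MulAction.toPerm a) (e.wave ρ v)).symm
    have h3 : ((ρ a : ℂ) - 1) * ∑ w, e.wave ρ v w = 0 := by linear_combination -h2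
    exact (mul_eq_zero.1 h3).resolve_left fun h4 => ha (Units.ext (sub_eq_zero.1 h4))

variable [Fintype V] [Fintype H] [Fintype K] [Fintype X.Edge]

open scoped Classical in
/-- The functions on which `G` acts through `ρ` are preserved by the Laplacian of the cover, which
acts on them by the twisted Laplacian, rescaled by the orders of the dilation groups. -/
theorem laplacian_mulVec_wave (e : p.Voltage) {ρ : G →* ℂˣ} {v : V} (hv : p.Undilated ρ v) (w : W) :
    (Y.laplacian.map ((↑) : ℤ → ℂ)).mulVec (e.wave ρ v) w =
      ∑ v' : {v // p.Undilated ρ v}, (Nat.card (p.dilation v'.1) *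
        ((X.twistedIncidence (e.charVoltage ρ)).conjTranspose *
          X.twistedIncidence (e.charVoltage ρ)) v'.1 v) * e.wave ρ v'.1 w := by
  obtain ⟨a, v', rfl⟩ : ∃ a v', a • e.base v' = w := ⟨_, _, e.label_smul_base w⟩
  obtain ⟨l, hs, ht, hl⟩ := e.exists_lift_sum_eq
  have hinner : ∀ h, ∑ g : G, (if Y.root (g • l h) = a • e.base v' then
      e.wave ρ v (a • e.base v') - e.wave ρ v (Y.root (Y.bar (g • l h))) else 0) =
      if X.root h = v' ∧ p.Undilated ρ v' then
        Nat.card (p.dilation v') * ((if v' = v then (1 : ℂ) else 0) - e.charVoltage ρ h *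
          (if X.root (X.bar h) = v then 1 else 0)) * ρ a else 0 := by
    intro h
    simp only [p.root_smul, p.bar_smul, hs, ht, smul_smul, e.wave_smul_base hv, smul_base_eq_iff,
      map_mul, Units.val_mul]
    by_cases h1 : X.root h = v'
    · have hterm : ∀ g : G, (if X.root h = v' ∧ a⁻¹ * g ∈ p.dilation v' then
          (if v' = v then (ρ a : ℂ) else 0) -
            (if X.root (X.bar h) = v then (ρ g : ℂ) * ρ (e.η h) else 0) else 0) =
          (if v' = v then (ρ a : ℂ) else 0) *
              (if a⁻¹ * g ∈ p.dilation v' then (((1 : G →* ℂˣ) g : ℂˣ) : ℂ) else 0) -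
            (if X.root (X.bar h) = v then (ρ (e.η h) : ℂ) else 0) *
              (if a⁻¹ * g ∈ p.dilation v' then (ρ g : ℂ) else 0) := by
        intro g
        simp only [h1, true_and, MonoidHom.one_apply, Units.val_one]
        split_ifs <;> ring
      have hone : p.Undilated (1 : G →* ℂˣ) v' := fun _ _ => rfl
      rw [sum_congr rfl fun g _ => hterm g, sum_sub_distrib, ← mul_sum, ← mul_sum,
        sum_coset_dilation, sum_coset_dilation, if_pos hone]
      by_cases hv' : p.Undilated ρ v'
      · simp only [h1, hv', and_self, if_true, charVoltage, MonoidHom.one_apply, Units.val_one]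
        split_ifs <;> ring
      · have hne : v' ≠ v := fun h2 => hv' (h2 ▸ hv)
        simp [hne, hv']
    · simp [h1]
  rw [map_laplacian_mulVec, hl, sum_congr rfl fun h _ => hinner h]
  by_cases hv' : p.Undilated ρ v'
  · rw [Fintype.sum_eq_single (⟨v', hv'⟩ : {v // p.Undilated ρ v})]
    · rw [e.wave_smul_base hv', if_pos rfl, conjTranspose_twistedIncidence_mul_self X
        (e.charVoltage_bar_mul ρ) (e.norm_charVoltage ρ), mul_sum, sum_mul]
      refine sum_congr rfl fun h _ => ?_
      by_cases h1 : X.root h = v' <;> simp [h1, hv']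
    · intro v'' hne
      rw [e.wave_smul_base v''.2, if_neg, mul_zero]
      rintro rfl
      exact hne rfl
  · rw [sum_eq_zero fun h _ => if_neg fun h1 => hv' h1.2, eq_comm]
    refine sum_eq_zero fun v'' _ => ?_
    rw [e.wave_smul_base v''.2, if_neg, mul_zero]
    rintro rfl
    exact hv' v''.2

end Voltage

end HarmonicCover

end SerreGraph

/-! ### The determinant of the cover as a product over the characters -/

namespace SerreGraph.HarmonicCover.Voltage

open Finset Matrix

variable {V H W K G : Type*} [CommGroup G] [Fintype G] [Fintype W] [MulAction G W] [MulAction G K]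
  {Y : SerreGraph W K} {X : SerreGraph V H} {p : HarmonicCover G Y X}

theorem card_quotient_eq (p : HarmonicCover G Y X) (v : V) :
    (Nat.card (G ⧸ p.dilation v) : ℂ) * Nat.card (p.dilation v) = Fintype.card G := by
  rw [← Nat.cast_mul, ← Subgroup.card_eq_card_quotient_mul_card_subgroup, Nat.card_eq_fintype_card]

theorem card_dilation_ne_zero (p : HarmonicCover G Y X) (v : V) :
    (Nat.card (p.dilation v) : ℂ) ≠ 0 :=
  Nat.cast_ne_zero.2 Nat.card_pos.ne'

variable [Fintype V] [Fintype H]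

open scoped Classical in
/-- The block of `L + J` of the cover at the character `ρ`, where `L` is the Laplacian and `J` has
all entries equal to `1`. The matrix `J` acts only on the `G`-invariant functions. -/
noncomputable def block [Fintype X.Edge] (e : p.Voltage) (ρ : G →* ℂˣ) :
    Matrix {v // p.Undilated ρ v} {v // p.Undilated ρ v} ℂ :=
  diagonal (fun v => (Nat.card (p.dilation v.1) : ℂ)) *
      ((e.coboundary ρ).conjTranspose * e.coboundary ρ) +
    if ρ = 1 then vecMulVec 1 (fun v => (Nat.card (G ⧸ p.dilation v.1) : ℂ)) else 0

open scoped Classical in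
theorem det_block_of_ne_one [Fintype X.Edge] (e : p.Voltage) (hY : Y.Connected) {ρ : G →* ℂˣ}
    (hρ : ρ ≠ 1) : (e.block ρ).det =
      (∏ v : {v // p.Undilated ρ v}, (Nat.card (p.dilation v.1) : ℂ)) *
        e.matroidWeight ρ (cokernelMatroid (e.coboundary ρ)) := by
  rw [block, if_neg hρ, add_zero, det_mul, det_diagonal,
    e.det_conjTranspose_coboundary_mul hY hρ]

open scoped Classical in
theorem det_block_one [Fintype X.Edge] [Nonempty V] (e : p.Voltage) : (e.block 1).det =
      (∏ v : {v // p.Undilated (1 : G →* ℂˣ) v}, (Nat.card (p.dilation v.1) : ℂ)) *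
        ((Fintype.card W : ℂ) ^ 2 / Fintype.card G * X.numSpanningTrees) := by
  let ι : {v // p.Undilated (1 : G →* ℂˣ) v} ≃ V := Equiv.subtypeUnivEquiv fun _ _ _ => rfl
  have hcob : (e.coboundary 1).conjTranspose * e.coboundary 1 =
      (X.laplacian.map ((↑) : ℤ → ℂ)).submatrix ι ι := by
    have h1 : e.charVoltage 1 = fun _ => 1 := rfl
    rw [← conjTranspose_incidence_mul_self, ← h1]
    rfl
  have hblock : e.block 1 = diagonal (fun v : {v // p.Undilated (1 : G →* ℂˣ) v} =>
      (Nat.card (p.dilation v.1) : ℂ)) * (X.laplacian.map ((↑) : ℤ → ℂ) +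
        vecMulVec (fun v => (Nat.card (p.dilation v) : ℂ)⁻¹)
          (fun v => (Nat.card (G ⧸ p.dilation v) : ℂ))).submatrix ι ι := by
    rw [block, if_pos rfl, hcob]
    ext v v'
    simp only [Matrix.add_apply, diagonal_mul, submatrix_apply, vecMulVec_apply, Pi.one_apply]
    rw [mul_add, ← mul_assoc, show ι v = v.1 from rfl,
      mul_inv_cancel₀ (card_dilation_ne_zero p v.1)]
    rfl
  have hG : (Fintype.card G : ℂ) ≠ 0 := Nat.cast_ne_zero.2 Fintype.card_ne_zero
  have hW : ∑ v, (Nat.card (G ⧸ p.dilation v) : ℂ) = Fintype.card W := by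
    rw [← e.sum_card_quotient_dilation, Nat.cast_sum]
  have hinv : ∑ v, (Nat.card (p.dilation v) : ℂ)⁻¹ = Fintype.card W / Fintype.card G := by
    rw [← hW, sum_div]
    refine sum_congr rfl fun v _ => ?_
    rw [← card_quotient_eq p v]
    have h1 := card_dilation_ne_zero p v
    have h2 : (Nat.card (G ⧸ p.dilation v) : ℂ) ≠ 0 := Nat.cast_ne_zero.2 Nat.card_pos.ne'
    field_simp
  rw [hblock, det_mul, det_diagonal, det_submatrix_equiv_self, det_laplacian_add_vecMulVec, hW,
    hinv]
  ring

variable [Fintype K]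

open scoped Classical in
theorem laplacian_add_mulVec_wave [Fintype X.Edge] (e : p.Voltage) {ρ : G →* ℂˣ} {v : V}
    (hv : p.Undilated ρ v) (w : W) :
    (Y.laplacian.map ((↑) : ℤ → ℂ) + vecMulVec 1 1).mulVec (e.wave ρ v) w =
      ∑ v' : {v // p.Undilated ρ v}, e.block ρ v' ⟨v, hv⟩ * e.wave ρ v'.1 w := by
  have hJ : (vecMulVec 1 1 : Matrix W W ℂ).mulVec (e.wave ρ v) w =
      ∑ v' : {v // p.Undilated ρ v},
        (if ρ = 1 then (Nat.card (G ⧸ p.dilation v) : ℂ) else 0) * e.wave ρ v'.1 w := by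
    have h1 : (vecMulVec 1 1 : Matrix W W ℂ).mulVec (e.wave ρ v) w = ∑ w, e.wave ρ v w := by
      simp [mulVec, dotProduct, vecMulVec_apply]
    rw [h1, e.sum_wave hv, ← mul_sum]
    by_cases hρ : ρ = 1
    · subst hρ
      rw [Fintype.sum_eq_single (⟨p.onV w, fun _ _ => rfl⟩ :
        {v // p.Undilated (1 : G →* ℂˣ) v})]
      · simp [wave]
      · intro v' hne
        refine if_neg fun h => hne (Subtype.ext h.symm)
    · simp [hρ]
  rw [add_mulVec, Pi.add_apply, e.laplacian_mulVec_wave hv, hJ, ← sum_add_distrib]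
  refine sum_congr rfl fun v' _ => ?_
  rw [← add_mul]
  congr 1
  rw [block, Matrix.add_apply, diagonal_mul]
  congr 1
  split_ifs with hρ
  · simp [vecMulVec_apply]
  · rfl

open scoped Classical in
theorem det_laplacian_add_eq_prod_block [Fintype X.Edge] [Fintype (G →* ℂˣ)] (e : p.Voltage) :
    (Y.laplacian.map ((↑) : ℤ → ℂ) + vecMulVec 1 1).det = ∏ ρ, (e.block ρ).det := by
  let I := {i : (G →* ℂˣ) × V // p.Undilated i.1 i.2}
  let B : Matrix I I ℂ := of fun i j =>
    if h : i.1.1 = j.1.1 then e.block j.1.1 ⟨i.1.2, h ▸ i.2⟩ ⟨j.1.2, j.2⟩ else 0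
  have hB : ∀ ρ v v' (h : p.Undilated ρ v) (h' : p.Undilated ρ v'),
      B ⟨(ρ, v), h⟩ ⟨(ρ, v'), h'⟩ = e.block ρ ⟨v, h⟩ ⟨v', h'⟩ := fun _ _ _ _ _ => dif_pos rfl
  let P : Matrix W I ℂ := of fun w i => e.wave i.1.1 i.1.2 w
  have hcard : Fintype.card W = Fintype.card I := by
    rw [← e.sum_card_quotient_dilation,
      sum_congr rfl fun v _ => (p.card_undilated_characters v).symm,
      ← Nat.card_sigma, Nat.card_eq_fintype_card]
    refine Fintype.card_congr ⟨fun x => ⟨(x.2.1, x.1), x.2.2⟩, fun i => ⟨i.1.2, i.1.1, i.2⟩,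
      fun _ => rfl, fun _ => rfl⟩
  -- the waves are linearly independent, since characters are
  have hP : ∀ c, P.mulVec c = 0 → c = 0 := by
    intro c hc
    have hlin := Fintype.linearIndependent_iff.1 ((linearIndependent_monoidHom G ℂ).comp
      (fun ρ : G →* ℂˣ => (Units.coeHom ℂ).comp ρ) (fun ρ ρ' h => by
        ext g
        exact congrArg (fun f : G →* ℂ => f g) h))
    let C : (G →* ℂˣ) × V → ℂ := fun x => if h : p.Undilated x.1 x.2 then c ⟨x, h⟩ else 0
    have hC : ∀ a v, ∑ ρ : G →* ℂˣ, C (ρ, v) * (ρ a : ℂ) = 0 := by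
      intro a v
      have h1 : P.mulVec c (a • e.base v) =
          ∑ x : (G →* ℂˣ) × V, e.wave x.1 x.2 (a • e.base v) * C x :=
        Fintype.sum_of_injective _ (Subtype.val_injective (p := fun i : (G →* ℂˣ) × V =>
          p.Undilated i.1 i.2)) _ _ (fun x hx => by
            rw [show C x = 0 from dif_neg fun h => hx ⟨⟨x, h⟩, rfl⟩, mul_zero]) fun i => by
            rw [show C i.1 = c i from dif_pos i.2]
            rfl
      rw [hc, Fintype.sum_prod_type] at h1
      refine Eq.trans (sum_congr rfl fun ρ _ => ?_) h1.symm
      rw [Fintype.sum_eq_single v]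
      · by_cases hv : p.Undilated ρ v
        · rw [e.wave_smul_base hv, if_pos rfl, mul_comm]
        · rw [show C (ρ, v) = 0 from dif_neg hv, mul_zero, zero_mul]
      · intro v' hne
        rw [wave, p.onV_smul, e.onV_base, if_neg hne.symm, zero_mul]
    ext ⟨⟨ρ, v⟩, hρ⟩
    have h1 := hlin (fun ρ => C (ρ, v)) (by
      ext a
      rw [Finset.sum_apply]
      exact hC a v) ρ
    rwa [show C (ρ, v) = c ⟨(ρ, v), hρ⟩ from dif_pos hρ] at h1
  have hTP : (Y.laplacian.map ((↑) : ℤ → ℂ) + vecMulVec 1 1) * P = P * B := by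
    ext w ⟨⟨ρ, v⟩, hv⟩
    have h1 := e.laplacian_add_mulVec_wave hv w
    refine Eq.trans h1 ?_
    rw [Matrix.mul_apply]
    refine Fintype.sum_of_injective (fun v' : {v // p.Undilated ρ v} => (⟨(ρ, v'.1), v'.2⟩ : I))
      (fun v' v'' h => ?_) _ _ (fun i hi => ?_) fun v' => ?_
    · exact Subtype.ext (congrArg (fun i : I => i.1.2) h)
    · have hne : i.1.1 ≠ ρ := by
        obtain ⟨⟨ρ', v'⟩, hv'⟩ := i
        rintro rfl
        exact hi ⟨⟨v', hv'⟩, rfl⟩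
      rw [show B i ⟨(ρ, v), hv⟩ = 0 from dif_neg hne, mul_zero]
    · rw [mul_comm]
      congr 1
      exact (hB ρ _ _ _ _).symm
  rw [det_eq_of_mul_eq_mul hcard _ B P hP hTP,
    det_eq_prod_toSquareBlock B (fun i => i.1.1) fun i j hij => dif_neg hij]
  refine prod_congr rfl fun ρ _ => ?_
  let κ : {v // p.Undilated ρ v} ≃ {i : I // i.1.1 = ρ} :=
    ⟨fun v => ⟨⟨(ρ, v.1), v.2⟩, rfl⟩,
      fun i => ⟨i.1.1.2, (congrArg (p.Undilated · i.1.1.2) i.2).mp i.1.2⟩,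
      fun _ => rfl, by
      rintro ⟨⟨⟨ρ', v⟩, hv⟩, rfl⟩
      rfl⟩
  rw [← det_submatrix_equiv_self κ]
  congr 1
  ext v v'
  exact hB ρ _ _ _ _

end SerreGraph.HarmonicCover.Voltage

theorem theorem1p1 {V H W K G : Type*} [Fintype V] [Fintype H] [Fintype W] [Fintype K]
    [CommGroup G] [Fintype G] [MulAction G W] [MulAction G K]
    (Y : SerreGraph W K) (X : SerreGraph V H) (hY : Y.Connected)
    (p : SerreGraph.HarmonicCover G Y X) (e : p.Voltage) :
    Nat.card Y.Jac = Y.numSpanningTrees ∧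
    Nat.card X.Jac = X.numSpanningTrees ∧
    ∃ M : (G →* ℂˣ) → Matroid X.Edge,
      (∀ ρ, ρ ≠ 1 → e.IsTwistedMatroid ρ (M ρ)) ∧
      (Nat.card Y.Jac : ℝ) =
        1 / (Fintype.card G : ℝ)
          * (∏ v : V, (Nat.card (p.dilation v) : ℝ) ^ (Fintype.card G / Nat.card (p.dilation v)))
          * (Nat.card X.Jac : ℝ)
          * ∏ᶠ (ρ : G →* ℂˣ) (_ : ρ ≠ 1), e.matroidWeight ρ (M ρ) := by
  classical
  have : Nonempty W := hY.nonempty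
  have : Nonempty V := ⟨p.onV (Classical.arbitrary W)⟩
  have := Fintype.ofFinite X.Edge
  have := Fintype.ofFinite (G →* ℂˣ)
  refine ⟨SerreGraph.card_jac_eq_numSpanningTrees, SerreGraph.card_jac_eq_numSpanningTrees,
    fun ρ => cokernelMatroid (e.coboundary ρ),
    fun ρ hρ => e.isTwistedMatroid_cokernelMatroid hY hρ, ?_⟩
  rw [SerreGraph.card_jac_eq_numSpanningTrees, SerreGraph.card_jac_eq_numSpanningTrees,
    finprod_congr fun ρ => finprod_eq_if, finprod_eq_prod_of_fintype, ← Finset.prod_filter,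
    Finset.filter_ne']
  have hdet := e.det_laplacian_add_eq_prod_block
  rw [SerreGraph.det_laplacian_add_vecMulVec, ← Finset.mul_prod_erase _ _ (Finset.mem_univ 1),
    e.det_block_one,
    Finset.prod_congr rfl fun ρ hρ => e.det_block_of_ne_one hY (Finset.ne_of_mem_erase hρ),
    Finset.prod_mul_distrib] at hdet
  -- each vertex is counted once for every character that is trivial on its dilation group
  have hdil : (∏ v : {v // p.Undilated (1 : G →* ℂˣ) v}, (Nat.card (p.dilation v.1) : ℂ)) *
      ∏ ρ ∈ Finset.univ.erase (1 : G →* ℂˣ),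
        ∏ v : {v // p.Undilated ρ v}, (Nat.card (p.dilation v.1) : ℂ) =
      ∏ v : V, (Nat.card (p.dilation v) : ℂ) ^ (Fintype.card G / Nat.card (p.dilation v)) := by
    rw [Finset.mul_prod_erase Finset.univ (fun ρ : G →* ℂˣ =>
      ∏ v : {v // p.Undilated ρ v}, (Nat.card (p.dilation v.1) : ℂ)) (Finset.mem_univ 1)]
    have hsub : ∀ ρ : G →* ℂˣ, ∏ v : {v // p.Undilated ρ v}, (Nat.card (p.dilation v.1) : ℂ) =
        ∏ v, if p.Undilated ρ v then (Nat.card (p.dilation v) : ℂ) else 1 := by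
      intro ρ
      rw [← Finset.prod_filter, Finset.prod_subtype (p := fun v => p.Undilated ρ v) _ (by simp)]
    rw [Finset.prod_congr rfl fun ρ _ => hsub ρ, Finset.prod_comm]
    refine Finset.prod_congr rfl fun v _ => ?_
    rw [← Finset.prod_filter, Finset.prod_const, ← Fintype.card_subtype,
      ← Nat.card_eq_fintype_card, p.card_undilated_characters]
    congr 1
    rw [← Nat.card_eq_fintype_card, Subgroup.card_eq_card_quotient_mul_card_subgroup
      (p.dilation v), Nat.mul_div_cancel _ Nat.card_pos]
  have hG : (Fintype.card G : ℂ) ≠ 0 := Nat.cast_ne_zero.2 Fintype.card_ne_zero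
  have hW : (Fintype.card W : ℂ) ≠ 0 := Nat.cast_ne_zero.2 Fintype.card_ne_zero
  simp only [Pi.one_apply, Finset.sum_const, Finset.card_univ, nsmul_eq_mul, mul_one] at hdet
  have hfinal : ((Y.numSpanningTrees : ℝ) : ℂ) = ((1 / (Fintype.card G : ℝ)
      * (∏ v : V, (Nat.card (p.dilation v) : ℝ) ^ (Fintype.card G / Nat.card (p.dilation v)))
      * (X.numSpanningTrees : ℝ)
      * ∏ ρ ∈ Finset.univ.erase (1 : G →* ℂˣ),
        e.matroidWeight ρ (cokernelMatroid (e.coboundary ρ)) : ℝ) : ℂ) := by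
    push_cast
    rw [← hdil]
    refine mul_left_cancel₀ (mul_ne_zero hW hW) (hdet.trans ?_)
    field_simp
  exact Complex.ofReal_injective hfinal
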